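/- **Setting.** Let $\mathbb X$, $\mathbb Y=\mathbb Y_1\times\cdots\times\mathbb Y_s$ ($s\ge 1$) and $\mathbb Z$ be finite-dimensional real Hilbert spaces. Consider $$\min_{y\in\mathbb Y,\,z\in\mathbb Z}\{p(y_1)+f(y)-\langle b,z\rangle \mid \mathcal F^*y+\mathcal G^*z=c\},$$ where $p:\mathbb Y_1\to(-\infty,+\infty]$ is closed proper convex, $f:\mathbb Y\to\mathbb R$ is convex and continuously differentiable with Lipschitz continuous gradient, $\mathcal F:\mathbb X\to\mathbb Y$ and $\mathcal G:\mathbb X\to\mathbb Z$ are linear, $b\in\mathbb Z$, $c\in\mathbb X$. Let $\widehat\Sigma^f\succeq0$ be a self-adjoint operator on $\mathbb Y$ such that $f(y)\le\widehat f(y,y'):=f(y')+\langle\nabla f(y'),y-y'\rangle+\frac12\langle y-y',\widehat\Sigma^f(y-y')\rangle$ for all $y,y'$. Let $\sigma>0$, $\tau\in(0,2)$, and $$\mathcal L_\sigma(y,z;(x,y')):=p(y_1)+\widehat f(y,y')-\langle b,z\rangle+\langle\mathcal F^*y+\mathcal G^*z-c,x\rangle+\tfrac\sigma2\|\mathcal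 F^*y+\mathcal G^*z-c\|^2 .$$ Let $\mathbf K$ be the set of $(x,y,z)$ with $0\in(\partial p(y_1);0)+\nabla f(y)+\mathcal Fx$, $\mathcal Gx=b$, $\mathcal F^*y+\mathcal G^*z=c$; assume $\mathbf K\ne\emptyset$. Write $\mathcal F x=(\mathcal F_1x;\dots;\mathcal F_sx)$, and let $\mathcal D_i:\mathbb Y_i\to\mathbb Y_i$ be self-adjoint with $\frac12\widehat\Sigma^f_{ii}+\sigma\mathcal F_i\mathcal F_i^*+\mathcal D_i\succ0$ for all $i$ and $\mathcal D:=\mathrm{diag}(\mathcal D_1,\dots,\mathcal D_s)\succeq-\frac12\widehat\Sigma^f$. **Algorithm (sGS-iPADMM).** Let $\{\tilde\varepsilon_k\}$ be nonnegative and summable, and $y^0_1\in\mathrm{dom}\,p$. A sequence $(x^k,y^k,z^k)$ is generated by the algorithm if for each $k\ge0$ there are $y_i^{k+1/2}$, $\tilde\delta_i^k$ ($i\ge2$) and $\delta_i^k$ ($i\ge 1$) with norms $\|\tilde\delta^k_i\|,\|\delta^k_i\|\le\tilde\varepsilon_k$ such that, with $\gamma^k:=\mathcal Gx^k-b+\sigma\mathcal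 G(\mathcal F^*y^{k+1}+\mathcal G^*z^{k+1}-c)$, * for $i=s,\dots,2$: $\tilde\delta^k_i\in\partial_{y_i}\mathcal L_\sigma\big((y^k_{<i};y_i^{k+1/2};y^{k+1/2}_{>i}),z^k;(x^k,y^k)\big)+\mathcal D_i(y_i^{k+1/2}-y_i^k)$; * for $i=1,\dots,s$: $\delta^k_i\in\partial_{y_i}\mathcal L_\sigma\big((y^{k+1}_{<i};y_i^{k+1};y^{k+1/2}_{>i}),z^k;(x^k,y^k)\big)+\mathcal D_i(y_i^{k+1}-y_i^k)$; * $\|\gamma^k\|\le\tilde\varepsilon_k$; * $x^{k+1}=x^k+\tau\sigma(\mathcal F^*y^{k+1}+\mathcal G^*z^{k+1}-c)$. Put $\tilde\delta_1^k:=\delta_1^k$. **Operators and constants.** Let $\mathcal N:=\widehat\Sigma^f+\sigma\mathcal F\mathcal F^*+\mathcal D$ with block-diagonal part $\mathcal N_d$ and strict block-upper triangular part $\mathcal N_u$, and $\mathcal N_{\rm sGS}:=\mathcal N_u\mathcal N_d^{-1}\mathcal N_u^*$. On $\mathbb Y\times\mathbb Z$ put $\mathcal P(y;z):=(\widehat\Sigma^fy;0)$,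 $\mathcal T(y;z):=\big((\mathcal D+\mathcal N_{\rm sGS}+\sigma\mathcal F\mathcal G^*[\mathcal G\mathcal G^*]^\dagger\mathcal G\mathcal F^*)y;0\big)$, where $\dagger$ is the Moore–Penrose pseudoinverse, $\mathcal Ax:=(\mathcal Fx;\mathcal Gx)$, $$\Theta:=\tau\sigma\big(\mathcal P+\mathcal T+\tfrac{(2-\tau)\sigma}{3}\mathcal A\mathcal A^*\big),\qquad \Xi:=\tau\sigma\big(\tfrac12\mathcal P+\mathcal T+\tfrac{(2-\tau)\sigma}{6}\mathcal A\mathcal A^*\big).$$ Let $\|(x;w)\|_\Omega^2:=\|x\|^2+\langle w,\Theta w\rangle$ on $\mathbb U:=\mathbb X\times(\mathbb Y\times\mathbb Z)$ and $\mathrm{dist}_\Omega(u,\mathbf K):=\inf_{u'\in\mathbf K}\|u-u'\|_\Omega$. Let $\zeta$ be the infimum of all $t>0$ with $t\,\Xi\succeq\Theta$ and $$\rho:=\max\Big\{\frac{6\sigma^2(\tau-1)^2\|\mathcal A^*\mathcal A\|+3}{\tau\sigma^2(2-\tau)},\frac{2\zeta\|\mathcal P+\mathcal T\|}{\tau\sigma}\Big\}\max\{\|\Theta\|,1\}.$$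 Let $\mathcal R(x,w):=\big(c-\mathcal A^*w;\ w-\mathrm{Prox}_\varphi(w-\nabla h(w)-\mathcal Ax)\big)$ with $\varphi(w)=p(y_1)$, $h(w)=f(y)-\langle b,z\rangle$ for $w=(y;z)$. **Theorem.** There is a constant $C\ge0$, depending only on the data above (spaces, $p,f,b,c,\mathcal F,\mathcal G,\sigma,\tau,\widehat\Sigma^f,\mathcal D_i$), such that the following holds. Let $u^k=(x^k,(y^k;z^k))$ be generated by the algorithm and let $v^k:=(x^k,(y^k;\Pi_{\mathrm{Range}(\mathcal G)}z^k))$ converge to $v^*\in\mathbf K$. Then $$\mathrm{dist}_\Omega(u^k,\mathbf K)=\mathrm{dist}_\Omega(v^k,\mathbf K)\qquad\forall k\ge0.$$ Suppose moreover that $b-\mathcal Gx^0=0$; that $\gamma^k=0$ for all $k\ge0$; that $\mathcal R$ is metric subregular at $v^*$ for $0$ with modulus $\kappa>0$, i.e. for some $r>0$, $\mathrm{dist}(u,\mathbf K)\le\kappa\|\mathcal R(u)\|$ whenever $\|u-v^*\|\le r$; and that there are $\tilde\eta_k\ge0$ with $\tilde\eta_k\to0$ and an integer $k_0$ such that $$\max_{1\le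 i\le s}\{\|\tilde\delta_i^k\|,\|\delta_i^k\|\}\le\tilde\eta_k\|v^k-v^{k+1}\|\qquad\forall k\ge k_0 .$$ Then, with $$\vartheta^k:=\sqrt{\frac{\kappa^2\rho}{1+\kappa^2\rho}}+C\,\tilde\eta_k ,$$ there is $\bar k\ge k_0$ such that $\sup_{k\ge\bar k}\vartheta^k<1$ and $$\mathrm{dist}_\Omega(u^{k+1},\mathbf K)\le\vartheta^k\,\mathrm{dist}_\Omega(u^k,\mathbf K)\qquad\forall k\ge\bar k ,$$ i.e. $\mathrm{dist}_\Omega(u^k,\mathbf K)$ converges Q-linearly for all sufficiently large $k$. -/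

import Mathlib

open Filter Topology
open scoped InnerProductSpace

noncomputable section

namespace SGSADMM

/-! ### Convex analysis in a finite-dimensional real Hilbert space -/

section Generic

variable {E E' : Type*} [NormedAddCommGroup E] [InnerProductSpace ℝ E] [FiniteDimensional ℝ E]
  [NormedAddCommGroup E'] [InnerProductSpace ℝ E'] [FiniteDimensional ℝ E']

/-- `θ : E → (-∞, +∞]` is a closed proper convex function (closed means lower semicontinuous,
convex means that the epigraph is convex). -/
structure ClosedProperConvex (θ : E → EReal) : Prop where
  ne_bot : ∀ x, θ x ≠ ⊥
  exists_ne_top : ∃ x, θ x ≠ ⊤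
  closed : LowerSemicontinuous θ
  convex : Convex ℝ {q : E × ℝ | θ q.1 ≤ (q.2 : EReal)}

/-- The subdifferential `∂θ(x)` of convex analysis. -/
def subdiff (θ : E → EReal) (x : E) : Set E :=
  {g | ∀ x', θ x + ((⟪g, x' - x⟫_ℝ : ℝ) : EReal) ≤ θ x'}

/-- The Moreau-Yosida proximal mapping
`Prox_θ(ν) = argmin_{x} { θ(x) + ½ ‖ν - x‖² }`; for closed proper convex `θ` the minimizer exists
and is unique. -/
def prox (θ : E → EReal) (ν : E) : E :=
  Classical.epsilon fun x => ∀ x',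
    θ x + ((1 / 2 * ‖ν - x‖ ^ 2 : ℝ) : EReal) ≤ θ x' + ((1 / 2 * ‖ν - x'‖ ^ 2 : ℝ) : EReal)

/-- Self-adjoint positive definite operators, `O ≻ 0`. (`O ⪰ 0` is `O.IsPositive`.) -/
def PosDef (O : E →L[ℝ] E) : Prop :=
  IsSelfAdjoint O ∧ ∀ x, x ≠ 0 → 0 < ⟪x, O x⟫_ℝ

/-- `‖v‖_O = √⟨v, O v⟩`, for a self-adjoint positive semidefinite operator `O`. -/
def opNorm (O : E →L[ℝ] E) (v : E) : ℝ := √(⟪v, O v⟫_ℝ)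

/-- `dist_O(v, H) = inf_{v' ∈ H} ‖v - v'‖_O`. -/
def opDist (O : E →L[ℝ] E) (v : E) (H : Set E) : ℝ :=
  sInf ((fun v' => opNorm O (v - v')) '' H)

theorem isCompl_orthogonal_ker (A : E →L[ℝ] E') :
    IsCompl (LinearMap.ker (A : E →ₗ[ℝ] E'))ᗮ (LinearMap.ker (A : E →ₗ[ℝ] E')) :=
  (Submodule.isCompl_orthogonal _).symm

/-- The Moore-Penrose pseudoinverse `A†`: project orthogonally onto `range A`, then invert the
bijection `(ker A)ᗮ → range A` induced by `A`. -/
def pinv (A : E →L[ℝ] E') : E' →L[ℝ] E :=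
  LinearMap.toContinuousLinearMap
    ((LinearMap.ker (A : E →ₗ[ℝ] E'))ᗮ.subtype ∘ₗ
      (LinearMap.kerComplementEquivRange (A : E →ₗ[ℝ] E')
        (isCompl_orthogonal_ker A)).symm.toLinearMap ∘ₗ
      ((LinearMap.range (A : E →ₗ[ℝ] E')).orthogonalProjectionOnto :
        E' →ₗ[ℝ] LinearMap.range (A : E →ₗ[ℝ] E')))

/-- The orthogonal projection onto the range of `A`. -/
def projRange (A : E →L[ℝ] E') (v : E') : E' :=
  (LinearMap.range (A : E →ₗ[ℝ] E')).starProjection v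

/-- The KKT residual mapping of `min { φ(w) + h(w) | 𝒜* w = c }`:
`ℛ(x, w) = (c - 𝒜* w ; w - Prox_φ(w - ∇h(w) - 𝒜 x))`. -/
def kktResidual (φ : E' → EReal) (h : E' → ℝ) (A : E →L[ℝ] E') (c : E)
    (u : WithLp 2 (E × E')) : WithLp 2 (E × E') :=
  WithLp.toLp 2
    (c - ContinuousLinearMap.adjoint A u.snd,
      u.snd - prox φ (u.snd - gradient h u.snd - A u.fst))

/-- `R` is metric subregular with modulus `κ` at `ū` for `0`, where `K` is the zero set of `R`. -/
def MetricSubregular (R : E → E') (K : Set E) (κ : ℝ) (ubar : E) : Prop :=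
  ∃ r > 0, ∀ u, ‖u - ubar‖ ≤ r → Metric.infDist u K ≤ κ * ‖R u‖

end Generic

/-! ### Block vectors and block operators on `Y₁ × ⋯ × Yₛ` -/

section Blocks

variable {s : ℕ} {Y : Fin s → Type*} [∀ i, NormedAddCommGroup (Y i)]
  [∀ i, InnerProductSpace ℝ (Y i)] [∀ i, FiniteDimensional ℝ (Y i)]

/-- The coordinate projection `y ↦ yᵢ`. -/
def blkProj (i : Fin s) : PiLp 2 Y →L[ℝ] Y i := PiLp.proj 2 Y i

/-- The coordinate inclusion `Yᵢ → Y₁ × ⋯ × Yₛ`. -/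
def blkIncl (i : Fin s) : Y i →L[ℝ] PiLp 2 Y :=
  LinearMap.toContinuousLinearMap
    ((WithLp.linearEquiv 2 ℝ (∀ i, Y i)).symm.toLinearMap ∘ₗ LinearMap.single ℝ Y i)

/-- The block `T_{ij} : Y_j → Y_i` of an operator `T`. -/
def block (T : PiLp 2 Y →L[ℝ] PiLp 2 Y) (i j : Fin s) : Y j →L[ℝ] Y i :=
  blkProj i ∘L T ∘L blkIncl j

/-- `diag(B₁, …, Bₛ)`. -/
def blockDiag (B : ∀ i, Y i →L[ℝ] Y i) : PiLp 2 Y →L[ℝ] PiLp 2 Y :=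
  ∑ i, blkIncl i ∘L B i ∘L blkProj i

/-- The strict block-upper triangular part of `T`. -/
def blockUpper (T : PiLp 2 Y →L[ℝ] PiLp 2 Y) : PiLp 2 Y →L[ℝ] PiLp 2 Y :=
  ∑ i, ∑ j ∈ Finset.Ioi i, blkIncl i ∘L block T i j ∘L blkProj j

/-- The block vector `(u_{<i} ; t ; v_{>i})`. -/
def splice (i : Fin s) (u : PiLp 2 Y) (t : Y i) (v : PiLp 2 Y) : PiLp 2 Y :=
  WithLp.toLp 2 (Function.update (fun j => if j < i then u j else v j) i t)

end Blocks

/-! ### The problem, its parameters and its operators -/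

/-- The data of
`min { p(y₁) + f(y) - ⟨b, z⟩ | F* y + G* z = c }`, `y ∈ Y₁ × ⋯ × Yₛ`, `z ∈ Z`,
together with the penalty parameter `σ`, the step-length `τ`, the majorizing operator `Σ̂ᶠ` (`Sig`)
and the proximal operators `𝒟₁, …, 𝒟ₛ`. Block `1` has index `0 : Fin s`. -/
structure Data (X : Type*) {s : ℕ} [NeZero s] (Y : Fin s → Type*) (Z : Type*)
    [NormedAddCommGroup X] [InnerProductSpace ℝ X]
    [∀ i, NormedAddCommGroup (Y i)] [∀ i, InnerProductSpace ℝ (Y i)]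
    [NormedAddCommGroup Z] [InnerProductSpace ℝ Z] where
  p : Y 0 → EReal
  f : PiLp 2 Y → ℝ
  b : Z
  c : X
  F : X →L[ℝ] PiLp 2 Y
  G : X →L[ℝ] Z
  σ : ℝ
  τ : ℝ
  Sig : PiLp 2 Y →L[ℝ] PiLp 2 Y
  D : ∀ i, Y i →L[ℝ] Y i

namespace Data

variable {X : Type*} {s : ℕ} [NeZero s] {Y : Fin s → Type*} {Z : Type*}
  [NormedAddCommGroup X] [InnerProductSpace ℝ X] [FiniteDimensional ℝ X]
  [∀ i, NormedAddCommGroup (Y i)] [∀ i, InnerProductSpace ℝ (Y i)]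
  [∀ i, FiniteDimensional ℝ (Y i)]
  [NormedAddCommGroup Z] [InnerProductSpace ℝ Z] [FiniteDimensional ℝ Z]
  (P : Data X Y Z)

/-- `F* y + G* z - c`. -/
def infeas (y : PiLp 2 Y) (z : Z) : X :=
  ContinuousLinearMap.adjoint P.F y + ContinuousLinearMap.adjoint P.G z - P.c

/-- The quadratic model `f̂(y, y') = f(y') + ⟨∇f(y'), y - y'⟩ + ½ ‖y - y'‖²_{Σ̂ᶠ}`. -/
def fhat (y y' : PiLp 2 Y) : ℝ :=
  P.f y' + ⟪gradient P.f y', y - y'⟫_ℝ + 1 / 2 * ⟪y - y', P.Sig (y - y')⟫_ℝ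

/-- The majorized augmented Lagrangian `ℒ_σ(y, z; (x, y'))`. -/
def augLag (y : PiLp 2 Y) (z : Z) (x : X) (y' : PiLp 2 Y) : EReal :=
  P.p (y 0) + ((P.fhat y y' - ⟪P.b, z⟫_ℝ + ⟪P.infeas y z, x⟫_ℝ
    + P.σ / 2 * ‖P.infeas y z‖ ^ 2 : ℝ) : EReal)

/-- The standing conditions on the data: `σ > 0`, `τ ∈ (0, 2)`, `p` is closed proper convex,
`f` is convex and continuously differentiable with Lipschitz continuous gradient, and `Σ̂ᶠ` is
self-adjoint positive semidefinite with `f(y) ≤ f̂(y, y')`. -/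
structure Standing : Prop where
  σ_pos : 0 < P.σ
  τ_pos : 0 < P.τ
  τ_lt : P.τ < 2
  p_cpc : ClosedProperConvex P.p
  f_convex : ConvexOn ℝ Set.univ P.f
  f_smooth : ContDiff ℝ 1 P.f
  f_lip : ∃ L, LipschitzWith L (gradient P.f)
  sig_pos : P.Sig.IsPositive
  majorize : ∀ y y', P.f y ≤ P.fhat y y'

/-- The solution set `K` of the KKT system
`0 ∈ (∂p(y₁); 0) + ∇f(y) + F x`, `G x - b = 0`, `F* y + G* z = c`. -/
def kktSet : Set (WithLp 2 (X × WithLp 2 (PiLp 2 Y × Z))) :=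
  {u | -((gradient P.f u.snd.fst + P.F u.fst) 0) ∈ subdiff P.p (u.snd.fst 0) ∧
    (∀ i, i ≠ 0 → (gradient P.f u.snd.fst + P.F u.fst) i = 0) ∧
    P.G u.fst - P.b = 0 ∧
    ContinuousLinearMap.adjoint P.F u.snd.fst + ContinuousLinearMap.adjoint P.G u.snd.snd = P.c}

/-- `𝒟 = diag(𝒟₁, …, 𝒟ₛ)`. -/
def Dop : PiLp 2 Y →L[ℝ] PiLp 2 Y := blockDiag P.D

/-- The conditions on the proximal terms: every `𝒟ᵢ` is self-adjoint,
`½ Σ̂ᶠᵢᵢ + σ Fᵢ Fᵢ* + 𝒟ᵢ ≻ 0` and `𝒟 ⪰ -½ Σ̂ᶠ`. -/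
structure ProxCond : Prop where
  selfAdjoint : ∀ i, IsSelfAdjoint (P.D i)
  posDef : ∀ i, PosDef ((1 / 2 : ℝ) • block P.Sig i i
    + P.σ • ((blkProj i ∘L P.F) ∘L ContinuousLinearMap.adjoint (blkProj i ∘L P.F)) + P.D i)
  lower : (P.Dop + (1 / 2 : ℝ) • P.Sig).IsPositive

/-- `𝒩 = Σ̂ᶠ + σ F F* + 𝒟`. -/
def Nop : PiLp 2 Y →L[ℝ] PiLp 2 Y :=
  P.Sig + P.σ • (P.F ∘L ContinuousLinearMap.adjoint P.F) + P.Dop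

/-- The block-diagonal part `𝒩_d` of `𝒩`. -/
def Nd : PiLp 2 Y →L[ℝ] PiLp 2 Y := blockDiag fun i => block P.Nop i i

/-- The strict block-upper triangular part `𝒩_u` of `𝒩`. -/
def Nu : PiLp 2 Y →L[ℝ] PiLp 2 Y := blockUpper P.Nop

/-- `𝒩_sGS = 𝒩_u 𝒩_d⁻¹ 𝒩_u*` (`𝒩_d` is invertible under `Standing` and `ProxCond`). -/
def Nsgs : PiLp 2 Y →L[ℝ] PiLp 2 Y :=
  P.Nu ∘L ContinuousLinearMap.inverse P.Nd ∘L ContinuousLinearMap.adjoint P.Nu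

/-- The operator `(y; z) ↦ (O y; 0)` on `Y × Z`. -/
def extendY (O : PiLp 2 Y →L[ℝ] PiLp 2 Y) :
    WithLp 2 (PiLp 2 Y × Z) →L[ℝ] WithLp 2 (PiLp 2 Y × Z) :=
  (WithLp.prodContinuousLinearEquiv 2 ℝ (PiLp 2 Y) Z).symm.toContinuousLinearMap ∘L
    ContinuousLinearMap.inl ℝ (PiLp 2 Y) Z ∘L O ∘L WithLp.fstL 2 ℝ (PiLp 2 Y) Z

/-- `𝒯(y; z) = ((𝒟 + 𝒩_sGS + σ F G* [G G*]† G F*) y; 0)`. -/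
def Tcal : WithLp 2 (PiLp 2 Y × Z) →L[ℝ] WithLp 2 (PiLp 2 Y × Z) :=
  extendY (P.Dop + P.Nsgs + P.σ • (P.F ∘L ContinuousLinearMap.adjoint P.G ∘L
    pinv (P.G ∘L ContinuousLinearMap.adjoint P.G) ∘L P.G ∘L ContinuousLinearMap.adjoint P.F))

/-- `𝒫(y; z) = (Σ̂ᶠ y; 0)`. -/
def Pop : WithLp 2 (PiLp 2 Y × Z) →L[ℝ] WithLp 2 (PiLp 2 Y × Z) := extendY P.Sig

/-- `𝒜 x = (F x; G x)`, so that `𝒜*(y; z) = F* y + G* z`. -/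
def Aop : X →L[ℝ] WithLp 2 (PiLp 2 Y × Z) :=
  (WithLp.prodContinuousLinearEquiv 2 ℝ (PiLp 2 Y) Z).symm.toContinuousLinearMap ∘L
    P.F.prod P.G

/-- `𝒜 𝒜*`. -/
def AAs : WithLp 2 (PiLp 2 Y × Z) →L[ℝ] WithLp 2 (PiLp 2 Y × Z) :=
  P.Aop ∘L ContinuousLinearMap.adjoint P.Aop

/-- `Θ = τσ (𝒫 + 𝒯 + ((2-τ)σ/3) 𝒜𝒜*)`. -/
def Theta : WithLp 2 (PiLp 2 Y × Z) →L[ℝ] WithLp 2 (PiLp 2 Y × Z) :=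
  (P.τ * P.σ) • (P.Pop + P.Tcal + ((2 - P.τ) * P.σ / 3) • P.AAs)

/-- `Ξ = τσ (½𝒫 + 𝒯 + ((2-τ)σ/6) 𝒜𝒜*)`. -/
def Xi : WithLp 2 (PiLp 2 Y × Z) →L[ℝ] WithLp 2 (PiLp 2 Y × Z) :=
  (P.τ * P.σ) • ((1 / 2 : ℝ) • P.Pop + P.Tcal + ((2 - P.τ) * P.σ / 6) • P.AAs)

/-- The smallest positive `ζ` with `ζ Ξ ⪰ Θ`. -/
def zeta : ℝ := sInf {t : ℝ | 0 < t ∧ (t • P.Xi - P.Theta).IsPositive}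

/-- The constant `ρ = max { (6σ²(τ-1)²‖𝒜*𝒜‖ + 3)/(τσ²(2-τ)), 2ζ‖𝒫+𝒯‖/(τσ) } max { ‖Θ‖, 1 }`. -/
def rho : ℝ :=
  max ((6 * P.σ ^ 2 * (P.τ - 1) ^ 2 * ‖ContinuousLinearMap.adjoint P.Aop ∘L P.Aop‖ + 3)
      / (P.τ * P.σ ^ 2 * (2 - P.τ)))
    (2 * P.zeta * ‖P.Pop + P.Tcal‖ / (P.τ * P.σ)) * max ‖P.Theta‖ 1

/-- The operator whose induced (semi)norm is `‖(x; w)‖²_Ω = ‖x‖² + ‖w‖²_Θ`. -/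
def Omega : WithLp 2 (X × WithLp 2 (PiLp 2 Y × Z)) →L[ℝ]
    WithLp 2 (X × WithLp 2 (PiLp 2 Y × Z)) :=
  (WithLp.prodContinuousLinearEquiv 2 ℝ X (WithLp 2 (PiLp 2 Y × Z))).symm.toContinuousLinearMap ∘L
    (ContinuousLinearMap.id ℝ X).prodMap P.Theta ∘L
    (WithLp.prodContinuousLinearEquiv 2 ℝ X (WithLp 2 (PiLp 2 Y × Z))).toContinuousLinearMap

/-- The KKT residual mapping for `φ(w) = p(y₁)`, `h(w) = f(y) - ⟨b, z⟩`,
`𝒜* w = F* y + G* z`, `w = (y; z)`. -/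
def residual : WithLp 2 (X × WithLp 2 (PiLp 2 Y × Z)) →
    WithLp 2 (X × WithLp 2 (PiLp 2 Y × Z)) :=
  kktResidual (fun w => P.p (w.fst 0)) (fun w => P.f w.fst - ⟪P.b, w.snd⟫_ℝ) P.Aop P.c

/-- `γ = ∇_z ℒ_σ(y⁺, z⁺; (x, y)) = G x - b + σ G (F* y⁺ + G* z⁺ - c)`. -/
def gam (x : X) (y' : PiLp 2 Y) (z' : Z) : Z :=
  P.G x - P.b + P.σ • P.G (P.infeas y' z')

/-- The sequences `x`, `y`, `z`, with half-step iterates `yh k = y^{k+1/2}` (only the blocks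
`2, …, s` of `yh k` are ever used) and error vectors `δt k i = δ̃ᵢᵏ` (`i ≥ 2`), `δ k i = δᵢᵏ`,
are generated by the inexact block sGS based indefinite-proximal ADMM with tolerances `ε k`. -/
structure IsRun (ε : ℕ → ℝ) (x : ℕ → X) (y yh : ℕ → PiLp 2 Y) (z : ℕ → Z)
    (δt δ : ℕ → ∀ i, Y i) : Prop where
  ε_nonneg : ∀ k, 0 ≤ ε k
  ε_summable : Summable ε
  init : P.p (y 0 0) ≠ ⊤
  step1 : ∀ k i, i ≠ 0 → ‖δt k i‖ ≤ ε k ∧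
    δt k i - P.D i (yh k i - y k i) ∈
      subdiff (fun t => P.augLag (splice i (y k) t (yh k)) (z k) (x k) (y k)) (yh k i)
  step2 : ∀ k i, ‖δ k i‖ ≤ ε k ∧
    δ k i - P.D i (y (k + 1) i - y k i) ∈
      subdiff (fun t => P.augLag (splice i (y (k + 1)) t (yh k)) (z k) (x k) (y k))
        (y (k + 1) i)
  step3 : ∀ k, ‖P.gam (x k) (y (k + 1)) (z (k + 1))‖ ≤ ε k
  step4 : ∀ k, x (k + 1) = x k + (P.τ * P.σ) • P.infeas (y (k + 1)) (z (k + 1))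

end Data

/-- The point `(x; (y; z))` of `X × (Y × Z)`. -/
def point {X V Z : Type*} (x : X) (y : V) (z : Z) : WithLp 2 (X × WithLp 2 (V × Z)) :=
  WithLp.toLp 2 (x, WithLp.toLp 2 (y, z))

end SGSADMM

end

/-! Write r = F*y + G*z - c. Subtracting the backward sweep from the forward one eliminates the
half-step iterates, so a sweep is a single proximal step in the whole of y, with extra term `𝒩_sGS`
and an aggregated error comparable to the block errors (`IsRun.sweep`). Since G x⁰ = b and every γ
vanishes, G xᵏ = b for all k and G rᵏ = 0 for k ≥ 1. This turns the change of z into the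
pseudoinverse term of 𝒯, and the step becomes implicit in the new r (`IsRun.isStep`).

Two estimates hold for such a step with error d. Monotonicity of ∂p against a KKT point, with a
sharp three-point inequality for ∇f, shows that the squared Ω-distance to that point drops by D
(`decrease`), up to a term linear in d (`IsStep.descent`). Nonexpansiveness of the proximal mapping
bounds the KKT residual at the new point by √(ρ₀ D) + ‖d‖ (`IsStep.norm_residual_le`).

Let A and B be the new and old Ω-distances to the KKT set and K = κ√ρ. Without errors, descent reads
A² + D ≤ B² and subregularity reads A ≤ K√D; eliminating D gives A² ≤ K²/(1+K²) B². With errors of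
size η times the step length, the squared step length is O(D) (`exists_step_sq_le_decrease`), so for
small η the errors are absorbed and cost a relative O(η), with constants independent of the run and
of κ (`exists_perturbed_decrease`, `contraction_factor`).

Ω induces only a seminorm, definite on X × Y × Range G. Convergence and subregularity are therefore
used for the projected iterates v, whose Ω-distance to the KKT set equals that of u. -/

set_option linter.unusedSectionVars false

namespace SGSADMM

/-! ### Subgradients and the proximal mapping -/

section ConvexAnalysis

variable {E : Type*} [NormedAddCommGroup E] [InnerProductSpace ℝ E]

theorem exists_coe_of_mem_subdiff {θ : E → EReal} (hbot : ∀ x, θ x ≠ ⊥) (htop : ∃ x, θ x ≠ ⊤)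
    {g x : E} (hg : g ∈ subdiff θ x) : ∃ α : ℝ, θ x = α := by
  obtain ⟨x', hx'⟩ := htop
  have h := hg x'
  induction hx : θ x with
  | bot => exact absurd hx (hbot x)
  | top =>
    rw [hx, EReal.top_add_coe] at h
    exact absurd (top_le_iff.mp h) hx'
  | coe a => exact ⟨a, rfl⟩

theorem subdiff_monotone {θ : E → EReal} (hbot : ∀ x, θ x ≠ ⊥) (htop : ∃ x, θ x ≠ ⊤)
    {g g' x x' : E} (hg : g ∈ subdiff θ x) (hg' : g' ∈ subdiff θ x') :
    0 ≤ ⟪g - g', x - x'⟫_ℝ := by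
  obtain ⟨α, hα⟩ := exists_coe_of_mem_subdiff hbot htop hg
  obtain ⟨β, hβ⟩ := exists_coe_of_mem_subdiff hbot htop hg'
  have h1 := hg x'
  have h2 := hg' x
  rw [hα, hβ] at h1 h2
  norm_cast at h1 h2
  have : ⟪g, x' - x⟫_ℝ = - ⟪g, x - x'⟫_ℝ := by rw [← inner_neg_right, neg_sub]
  rw [inner_sub_left]
  linarith

/-- Splitting a smooth summand with an exact second-order expansion off a subgradient. -/
theorem sub_mem_subdiff_of_add {θ : E → EReal} (hbot : ∀ x, θ x ≠ ⊥)
    (hconv : Convex ℝ {q : E × ℝ | θ q.1 ≤ (q.2 : EReal)}) {ψ : E → ℝ} {g a x : E}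
    (hx : θ x ≠ ⊤)
    (hψ : ∀ h, ∃ q : ℝ, ∀ l : ℝ, ψ (x + l • h) = ψ x + l * ⟪a, h⟫_ℝ + l ^ 2 * q)
    (hg : g ∈ subdiff (fun t => θ t + (ψ t : EReal)) x) : g - a ∈ subdiff θ x := by
  intro x'
  obtain ⟨α, hα⟩ : ∃ α : ℝ, θ x = α := by
    induction hx' : θ x with
    | bot => exact absurd hx' (hbot x)
    | top => exact absurd hx' hx
    | coe a => exact ⟨a, rfl⟩
  by_cases hx' : θ x' = ⊤
  · rw [hx']; exact le_top
  obtain ⟨β, hβ⟩ : ∃ β : ℝ, θ x' = β := by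
    induction hx'' : θ x' with
    | bot => exact absurd hx'' (hbot x')
    | top => exact absurd hx'' hx'
    | coe a => exact ⟨a, rfl⟩
  obtain ⟨q, hq⟩ := hψ (x' - x)
  -- Convexity of θ on the segment and the subgradient inequality at x + l(x' - x), divided by l,
  -- leave only the second-order error l q, which disappears as l tends to 0 from the right.
  -- Convexity of ψ plays no role.
  have key : ∀ l : ℝ, 0 < l → l ≤ 1 → ⟪g - a, x' - x⟫_ℝ ≤ β - α + l * q := by
    intro l hl hl1
    have h1 := hconv (x := (x, α)) (y := (x', β)) (by simp [hα]) (by simp [hβ])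
      (sub_nonneg.mpr hl1) hl.le (by ring)
    simp only [Prod.smul_mk, Prod.mk_add_mk, smul_eq_mul, Set.mem_ofPred_eq] at h1
    have hpt : (1 - l) • x + l • x' = x + l • (x' - x) := by module
    rw [hpt] at h1
    have h2 := hg (x + l • (x' - x))
    simp only [add_sub_cancel_left, hα] at h2
    have h3 := h2.trans (add_le_add_left h1 (ψ (x + l • (x' - x)) : EReal))
    norm_cast at h3
    rw [hq, inner_smul_right] at h3
    rw [inner_sub_left]
    have h4 : l * (⟪g, x' - x⟫_ℝ - ⟪a, x' - x⟫_ℝ) ≤ l * (β - α + l * q) := by linarith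
    exact le_of_mul_le_mul_left h4 hl
  have hlim : Tendsto (fun l : ℝ => β - α + l * q) (𝓝[>] 0) (𝓝 (β - α + 0 * q)) :=
    (Continuous.tendsto (by fun_prop) 0).mono_left nhdsWithin_le_nhds
  have hle : ⟪g - a, x' - x⟫_ℝ ≤ β - α + 0 * q := by
    refine ge_of_tendsto hlim ?_
    filter_upwards [Ioo_mem_nhdsGT (zero_lt_one' ℝ)] with l hl using key l hl.1 hl.2.le
  rw [hα, hβ]
  norm_cast
  linarith

theorem norm_sub_add_smul_sq (ν x h : E) (l : ℝ) :
    (1 / 2 * ‖ν - (x + l • h)‖ ^ 2 : ℝ)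
      = 1 / 2 * ‖ν - x‖ ^ 2 + l * ⟪x - ν, h⟫_ℝ + l ^ 2 * (1 / 2 * ‖h‖ ^ 2) := by
  have : ν - (x + l • h) = (ν - x) - l • h := by abel
  rw [this, norm_sub_sq_real, inner_smul_right, norm_smul, mul_pow, Real.norm_eq_abs, sq_abs,
    ← neg_sub ν x, inner_neg_left]
  ring

/-- The affine minorant supplied by g makes the objective at x' at least its value at x plus ½‖x' -
x‖² - ⟪ν - x - g, x' - x⟫, which is no smaller than the value at x once ‖x' - x‖ ≥ 2‖ν - x - g‖. It
remains to minimise a lower semicontinuous function on a compact ball. -/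
theorem exists_prox_min [FiniteDimensional ℝ E] {θ : E → EReal} (hθ : ClosedProperConvex θ)
    {g x : E} (hg : g ∈ subdiff θ x) (ν : E) :
    ∃ m, ∀ x', θ m + ((1 / 2 * ‖ν - m‖ ^ 2 : ℝ) : EReal)
      ≤ θ x' + ((1 / 2 * ‖ν - x'‖ ^ 2 : ℝ) : EReal) := by
  set φ : E → EReal := fun x' => θ x' + ((1 / 2 * ‖ν - x'‖ ^ 2 : ℝ) : EReal) with hφ
  obtain ⟨α, hα⟩ := exists_coe_of_mem_subdiff hθ.ne_bot hθ.exists_ne_top hg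
  have hlsc : LowerSemicontinuous φ := by
    refine hθ.closed.add' ?_ ?_
    · exact (continuous_coe_real_ereal.comp (by fun_prop)).lowerSemicontinuous
    · intro z
      exact EReal.continuousAt_add (Or.inr (EReal.coe_ne_bot _)) (Or.inr (EReal.coe_ne_top _))
  set R := 2 * ‖ν - x - g‖
  obtain ⟨m, -, hm⟩ := LowerSemicontinuousOn.exists_isMinOn (f := φ)
    (s := Metric.closedBall x R) ⟨x, Metric.mem_closedBall_self (by positivity)⟩
    (isCompact_closedBall x R) (hlsc.lowerSemicontinuousOn _)
  refine ⟨m, fun x' => ?_⟩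
  by_cases hx' : x' ∈ Metric.closedBall x R
  · exact hm hx'
  have h1 : φ m ≤ φ x := hm (Metric.mem_closedBall_self (by positivity))
  refine h1.trans ?_
  have h2 := add_le_add_left (hg x') ((1 / 2 * ‖ν - x'‖ ^ 2 : ℝ) : EReal)
  refine le_trans ?_ h2
  simp only [hφ, hα]
  norm_cast
  have h3 : ‖ν - x'‖ ^ 2 = ‖ν - x‖ ^ 2 - 2 * ⟪ν - x, x' - x⟫_ℝ + ‖x' - x‖ ^ 2 := by
    rw [← norm_sub_sq_real]; congr 2; abel
  have h4 := real_inner_le_norm (ν - x - g) (x' - x)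
  rw [inner_sub_left] at h4
  have h5 : R < ‖x' - x‖ := by
    rw [Metric.mem_closedBall, dist_eq_norm] at hx'; exact not_le.mp hx'
  nlinarith [norm_nonneg (x' - x)]

/-- The proximal mapping is nonexpansive, and `Prox_θ (x + g) = x` for `g ∈ ∂θ(x)`. -/
theorem norm_sub_prox_le [FiniteDimensional ℝ E] {θ : E → EReal} (hθ : ClosedProperConvex θ)
    {g x : E} (hg : g ∈ subdiff θ x) (ν : E) : ‖x - prox θ ν‖ ≤ ‖x + g - ν‖ := by
  have hm := Classical.epsilon_spec (exists_prox_min hθ hg ν)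
  change ∀ x', θ (prox θ ν) + ((1 / 2 * ‖ν - prox θ ν‖ ^ 2 : ℝ) : EReal) ≤ _ at hm
  set m := prox θ ν
  have h0 : (0 : E) ∈ subdiff (fun t => θ t + ((1 / 2 * ‖ν - t‖ ^ 2 : ℝ) : EReal)) m := by
    intro x'
    rw [inner_zero_left, EReal.coe_zero, add_zero]
    exact hm x'
  have hmt : θ m ≠ ⊤ := by
    obtain ⟨α, hα⟩ := exists_coe_of_mem_subdiff (θ := fun t => θ t +
      ((1 / 2 * ‖ν - t‖ ^ 2 : ℝ) : EReal))
      (fun t => EReal.add_ne_bot_iff.mpr ⟨hθ.ne_bot t, EReal.coe_ne_bot _⟩)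
      (hθ.exists_ne_top.imp fun t ht => EReal.add_ne_top ht (EReal.coe_ne_top _)) h0
    intro h
    simp only [h, EReal.top_add_coe] at hα
    exact EReal.top_ne_coe _ hα
  have h1 := sub_mem_subdiff_of_add (a := m - ν) hθ.ne_bot hθ.convex hmt
    (fun h => ⟨1 / 2 * ‖h‖ ^ 2, fun l => norm_sub_add_smul_sq ν m h l⟩) h0
  -- Optimality of m puts ν - m in ∂θ(m); monotonicity then reads ‖x - m‖² ≤ ⟪x + g - ν, x - m⟫, and
  -- Cauchy-Schwarz finishes.
  have h2 := subdiff_monotone hθ.ne_bot hθ.exists_ne_top hg h1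
  have h3 : g - (0 - (m - ν)) = (x + g - ν) - (x - m) := by abel
  rw [h3, inner_sub_left, real_inner_self_eq_norm_sq] at h2
  have h4 := real_inner_le_norm (x + g - ν) (x - m)
  by_contra! h
  nlinarith [norm_nonneg (x + g - ν)]

theorem ClosedProperConvex.comp_continuousLinearMap {V : Type*} [NormedAddCommGroup V]
    [InnerProductSpace ℝ V] {θ : E → EReal} (hθ : ClosedProperConvex θ) (B : V →L[ℝ] E)
    (hB : Function.Surjective B) : ClosedProperConvex fun v => θ (B v) where
  ne_bot v := hθ.ne_bot _
  exists_ne_top := by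
    obtain ⟨x, hx⟩ := hθ.exists_ne_top
    obtain ⟨v, rfl⟩ := hB x
    exact ⟨v, hx⟩
  closed := hθ.closed.comp B.continuous
  convex := by
    intro q hq r hr a b ha hb hab
    have := hθ.convex (x := (B q.1, q.2)) (y := (B r.1, r.2)) hq hr ha hb hab
    simpa using this

end ConvexAnalysis

/-! ### Gradient inequalities for convex functions with a quadratic majorant -/

section Smooth

variable {E : Type*} [NormedAddCommGroup E] [InnerProductSpace ℝ E]

theorem gradient_inequality [CompleteSpace E] {f : E → ℝ} (hf : ConvexOn ℝ Set.univ f)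
    (hd : Differentiable ℝ f) (a b : E) : f b + ⟪gradient f b, a - b⟫_ℝ ≤ f a := by
  have hline : HasDerivAt (fun l : ℝ => f (b + l • (a - b))) ⟪gradient f b, a - b⟫_ℝ 0 := by
    have h1 : HasFDerivAt f (InnerProductSpace.toDual ℝ E (gradient f b)) (b + (0 : ℝ) • (a - b)) := by
      simpa using (hd b).hasGradientAt.hasFDerivAt
    have h2 : HasDerivAt (fun l : ℝ => b + l • (a - b)) (a - b) 0 := by
      simpa using ((hasDerivAt_id (0 : ℝ)).smul_const (a - b)).const_add b
    exact h1.comp_hasDerivAt (0 : ℝ) h2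
  have hlim := hline.tendsto_slope_zero_right
  refine le_of_tendsto (hlim.const_add (f b)) ?_
  filter_upwards [Ioo_mem_nhdsGT (zero_lt_one' ℝ)] with l hl
  have h1 := hf.2 (Set.mem_univ b) (Set.mem_univ a) (sub_nonneg.mpr hl.2.le) hl.1.le (by ring)
  have hpt : (1 - l) • b + l • a = b + l • (a - b) := by module
  rw [hpt] at h1
  simp only [smul_eq_mul, zero_add, zero_smul, add_zero] at h1 ⊢
  have h2 : l⁻¹ * (f (b + l • (a - b)) - f b) ≤ f a - f b := by
    rw [inv_mul_le_iff₀ hl.1]; linarith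
  linarith

variable {f : E → ℝ} {df : E → E} {Q : E →L[ℝ] E}

/-- Probing at both a + v and b - v, with v half of c - a, and adding the four bounds cancels all
function values. Probing at c alone would give only the constant 1/2. The constant 1/4 leaves ½𝒫 in
the decrease, and hence permits 𝒟 ⪰ -½Σ̂ᶠ. -/
theorem three_point_gradient (hlow : ∀ a b, f b + ⟪df b, a - b⟫_ℝ ≤ f a)
    (hup : ∀ a b, f a ≤ f b + ⟪df b, a - b⟫_ℝ + 1 / 2 * ⟪a - b, Q (a - b)⟫_ℝ) (a b c : E) :
    -(1 / 4) * ⟪c - a, Q (c - a)⟫_ℝ ≤ ⟪df a - df b, c - b⟫_ℝ := by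
  set v : E := (1 / 2 : ℝ) • (c - a) with hv
  have h1 := hup (a + v) a
  have h2 := hlow (a + v) b
  have h3 := hup (b - v) b
  have h4 := hlow (b - v) a
  have e1 : a + v - a = v := by abel
  have e2 : b - v - b = -v := by abel
  have e3 : a + v - b = (a - b) + v := by abel
  have e4 : b - v - a = -(a - b) - v := by abel
  rw [e1] at h1
  rw [e2] at h3
  rw [e3] at h2
  rw [e4] at h4
  simp only [map_neg, inner_neg_right, inner_neg_left, inner_add_right, inner_sub_right] at h1 h2 h3 h4
  have e5 : c - b = (a - b) + (2 : ℝ) • v := by rw [hv]; module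
  have e6 : c - a = (2 : ℝ) • v := by rw [hv]; module
  rw [e5, e6]
  simp only [map_smul, inner_smul_left, inner_smul_right, inner_add_right, inner_sub_left,
    inner_sub_right, RCLike.conj_to_real] at *
  linarith

/-- Heuristically the gradient difference is H(a - b) with 0 ⪯ H ⪯ Q, so H - ½Q lies between -½Q and
½Q. No Hessian is needed: the lower and upper bounds are compared at the two points obtained from
the midpoint of a and b by adding and subtracting v/2. -/
theorem gradient_deviation (hQ : ∀ u v, ⟪Q u, v⟫_ℝ = ⟪u, Q v⟫_ℝ)
    (hlow : ∀ a b, f b + ⟪df b, a - b⟫_ℝ ≤ f a)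
    (hup : ∀ a b, f a ≤ f b + ⟪df b, a - b⟫_ℝ + 1 / 2 * ⟪a - b, Q (a - b)⟫_ℝ) (a b v : E) :
    ⟪v, df a - df b - (1 / 2 : ℝ) • Q (a - b)⟫_ℝ
      ≤ 1 / 4 * (⟪a - b, Q (a - b)⟫_ℝ + ⟪v, Q v⟫_ℝ) := by
  set e : E := (1 / 2 : ℝ) • (a - b) with he
  set w : E := (1 / 2 : ℝ) • v with hw
  have h1 := hup (a - e + w) b
  have h2 := hlow (a - e + w) a
  have h3 := hup (a - e - w) a
  have h4 := hlow (a - e - w) b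
  have e0 : a - b = (2 : ℝ) • e := by rw [he]; module
  have e0' : v = (2 : ℝ) • w := by rw [hw]; module
  have e1 : a - e + w - a = w - e := by abel
  have e2 : a - e - w - a = -(w + e) := by abel
  have e3 : a - e + w - b = w + e := by
    rw [show a - e + w - b = (a - b) - e + w by abel, e0]; module
  have e4 : a - e - w - b = e - w := by
    rw [show a - e - w - b = (a - b) - e - w by abel, e0]; module
  rw [e3] at h1
  rw [e1] at h2
  rw [e2] at h3
  rw [e4] at h4
  rw [e0, e0']
  have hs : ⟪w, Q e⟫_ℝ = ⟪e, Q w⟫_ℝ := by rw [← hQ, real_inner_comm]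
  have c1 := real_inner_comm w (df a)
  have c2 := real_inner_comm w (df b)
  simp only [map_smul, map_add, map_sub, map_neg, inner_smul_left, inner_smul_right,
    inner_add_right, inner_sub_left, inner_add_left, inner_neg_right, inner_neg_left,
    inner_sub_right, RCLike.conj_to_real] at *
  linarith

/-- Testing with v = l e and optimising over l gives l = 1/‖S‖. If S = 0 the bound is linear in l,
and letting l grow forces e = 0. -/
theorem norm_sq_le_of_inner_le {S : E →L[ℝ] E} {e : E} {q : ℝ}
    (h : ∀ v, ⟪v, e⟫_ℝ ≤ 1 / 2 * (⟪v, S v⟫_ℝ + q)) : ‖e‖ ^ 2 ≤ ‖S‖ * q := by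
  have h1 : ∀ l : ℝ, 2 * l * ‖e‖ ^ 2 ≤ l ^ 2 * (‖S‖ * ‖e‖ ^ 2) + q := by
    intro l
    have := h (l • e)
    simp only [map_smul, inner_smul_left, inner_smul_right, RCLike.conj_to_real,
      real_inner_self_eq_norm_sq] at this
    have h2 : ⟪e, S e⟫_ℝ ≤ ‖S‖ * ‖e‖ ^ 2 := by
      calc ⟪e, S e⟫_ℝ ≤ ‖e‖ * ‖S e‖ := real_inner_le_norm _ _
        _ ≤ ‖e‖ * (‖S‖ * ‖e‖) := by gcongr; exact S.le_opNorm e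
        _ = _ := by ring
    nlinarith [sq_nonneg l]
  rcases (norm_nonneg S).eq_or_lt with h0 | h0
  · rw [← h0] at h1 ⊢
    by_contra! hc
    have := h1 ((q + 1) / (2 * ‖e‖ ^ 2))
    have hne : ‖e‖ ^ 2 ≠ 0 := by intro h'; rw [h'] at hc; simp at hc
    have h2 : 2 * ((q + 1) / (2 * ‖e‖ ^ 2)) * ‖e‖ ^ 2 = q + 1 := by
      generalize ‖e‖ ^ 2 = n at hne
      field_simp
    rw [h2] at this
    linarith
  · have := h1 (1 / ‖S‖)
    field_simp at this
    nlinarith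

end Smooth

/-! ### Coercivity, the pseudoinverse and projection onto the range -/

section Operators

variable {E E' : Type*} [NormedAddCommGroup E] [InnerProductSpace ℝ E] [FiniteDimensional ℝ E]
  [NormedAddCommGroup E'] [InnerProductSpace ℝ E'] [FiniteDimensional ℝ E']

/-- The constant is the minimum of q on the compact unit sphere of V, extended to V by homogeneity.
-/
theorem exists_coercive_on {q : E → ℝ} (hq : Continuous q)
    (hsmul : ∀ (l : ℝ) v, q (l • v) = l ^ 2 * q v) (V : Submodule ℝ E)
    (hpos : ∀ v ∈ V, v ≠ 0 → 0 < q v) : ∃ m > 0, ∀ v ∈ V, m * ‖v‖ ^ 2 ≤ q v := by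
  set K : Set E := Metric.sphere 0 1 ∩ V
  have hK : IsCompact K := (isCompact_sphere 0 1).inter_right V.closed_of_finiteDimensional
  have hscale : ∀ v ∈ V, v ≠ 0 → ‖v‖⁻¹ • v ∈ K := fun v hv h0 =>
    ⟨by simp [norm_smul, h0], V.smul_mem _ hv⟩
  rcases K.eq_empty_or_nonempty with hE | hne
  · refine ⟨1, one_pos, fun v hv => ?_⟩
    by_cases h0 : v = 0
    · have := hsmul 0 0
      simp only [smul_zero] at this
      subst h0; rw [this]; simp
    · exact absurd (hscale v hv h0) (by simp [hE])
  · obtain ⟨v₀, hv₀, hmin⟩ := hK.exists_isMinOn hne hq.continuousOn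
    have h1 : v₀ ≠ 0 := by
      rintro rfl; simpa using hv₀.1
    refine ⟨q v₀, hpos v₀ hv₀.2 h1, fun v hv => ?_⟩
    by_cases h0 : v = 0
    · have := hsmul 0 0
      simp only [smul_zero] at this
      subst h0; rw [this]; simp
    · have h2 : q v₀ ≤ q (‖v‖⁻¹ • v) := hmin (hscale v hv h0)
      rw [hsmul] at h2
      have h3 : 0 < ‖v‖ := norm_pos_iff.mpr h0
      field_simp at h2
      linarith

theorem apply_pinv (A : E →L[ℝ] E') (a : E') :
    A (pinv A a) = (LinearMap.range (A : E →ₗ[ℝ] E')).starProjection a := by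
  simp only [pinv, LinearMap.coe_toContinuousLinearMap', LinearMap.comp_apply]
  have := (LinearMap.kerComplementEquivRange (A : E →ₗ[ℝ] E') (isCompl_orthogonal_ker A)).apply_symm_apply
    ((LinearMap.range (A : E →ₗ[ℝ] E')).orthogonalProjectionOnto a)
  rw [Submodule.starProjection_apply, ← this]
  simp

theorem pinv_mem (A : E →L[ℝ] E') (a : E') :
    pinv A a ∈ (LinearMap.ker (A : E →ₗ[ℝ] E'))ᗮ := by
  simp [pinv]

/-- A continuous linear map `B` with `⟪B u, v⟫ = ⟪u, B v⟫` has `(ker B)ᗮ = range B`. -/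
theorem mem_range_of_mem_orthogonal_ker {B : E →L[ℝ] E} (hB : IsSelfAdjoint B) {v : E}
    (hv : v ∈ (LinearMap.ker (B : E →ₗ[ℝ] E))ᗮ) : v ∈ LinearMap.range (B : E →ₗ[ℝ] E) := by
  have h := ContinuousLinearMap.orthogonal_range B
  rw [hB.adjoint_eq] at h
  rw [← Submodule.orthogonal_orthogonal (LinearMap.range (B : E →ₗ[ℝ] E))]
  exact h ▸ hv

theorem inner_pinv_left {B : E →L[ℝ] E} (hB : IsSelfAdjoint B) (a b : E) :
    ⟪pinv B a, b⟫_ℝ = ⟪pinv B a, B (pinv B b)⟫_ℝ := by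
  rw [apply_pinv, ← Submodule.inner_starProjection_left_eq_right,
    Submodule.starProjection_eq_self_iff.mpr
      (mem_range_of_mem_orthogonal_ker hB (pinv_mem B a))]

theorem inner_pinv_symm {B : E →L[ℝ] E} (hB : IsSelfAdjoint B) (a b : E) :
    ⟪pinv B a, b⟫_ℝ = ⟪a, pinv B b⟫_ℝ := by
  have h : ⟪B (pinv B a), pinv B b⟫_ℝ = ⟪pinv B a, B (pinv B b)⟫_ℝ :=
    ContinuousLinearMap.isSelfAdjoint_iff_isSymmetric.mp hB _ _
  rw [inner_pinv_left hB, ← h, real_inner_comm, real_inner_comm (pinv B b) a]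
  exact (inner_pinv_left hB b a).symm

theorem isSelfAdjoint_comp_adjoint (A : E →L[ℝ] E') :
    IsSelfAdjoint (A ∘L ContinuousLinearMap.adjoint A) := by
  rw [ContinuousLinearMap.isSelfAdjoint_iff']
  simp [ContinuousLinearMap.adjoint_comp]

theorem inner_pinv_gram (A : E →L[ℝ] E') (a : E') :
    ⟪a, pinv (A ∘L ContinuousLinearMap.adjoint A) a⟫_ℝ
      = ‖ContinuousLinearMap.adjoint A (pinv (A ∘L ContinuousLinearMap.adjoint A) a)‖ ^ 2 := by
  rw [real_inner_comm, inner_pinv_left (isSelfAdjoint_comp_adjoint A),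
    ContinuousLinearMap.comp_apply, ← ContinuousLinearMap.adjoint_inner_left,
    real_inner_self_eq_norm_sq]

/-- A*(AA*)†A is the orthogonal projection onto the range of A*. Here it suffices that AA* and A*
have the same kernel. -/
theorem adjoint_pinv_gram_apply (A : E →L[ℝ] E') (w : E') :
    ContinuousLinearMap.adjoint A (pinv (A ∘L ContinuousLinearMap.adjoint A)
      (A (ContinuousLinearMap.adjoint A w))) = ContinuousLinearMap.adjoint A w := by
  set B := A ∘L ContinuousLinearMap.adjoint A
  have h1 : B (pinv B (B w)) = B w := by
    rw [apply_pinv]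
    exact Submodule.starProjection_eq_self_iff.mpr ⟨w, rfl⟩
  have h2 : B (pinv B (B w) - w) = 0 := by rw [map_sub, h1, sub_self]
  have h3 : ContinuousLinearMap.adjoint A (pinv B (B w) - w) = 0 := by
    rw [← norm_eq_zero, ← sq_eq_zero_iff, ← real_inner_self_eq_norm_sq,
      ContinuousLinearMap.adjoint_inner_left]
    change ⟪_, B (pinv B (B w) - w)⟫_ℝ = 0
    rw [h2, inner_zero_right]
  rw [map_sub, sub_eq_zero] at h3
  exact h3

theorem adjoint_projRange (A : E →L[ℝ] E') (v : E') :
    ContinuousLinearMap.adjoint A (projRange A v) = ContinuousLinearMap.adjoint A v := by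
  refine ext_inner_right ℝ fun x => ?_
  have hx : A x ∈ LinearMap.range (A : E →ₗ[ℝ] E') := ⟨x, rfl⟩
  rw [ContinuousLinearMap.adjoint_inner_left, ContinuousLinearMap.adjoint_inner_left, projRange,
    Submodule.inner_starProjection_left_eq_right,
    Submodule.starProjection_eq_self_iff.mpr hx]

theorem eq_zero_of_mem_range_of_adjoint_eq_zero (A : E →L[ℝ] E') {v : E'}
    (hv : v ∈ LinearMap.range (A : E →ₗ[ℝ] E')) (h : ContinuousLinearMap.adjoint A v = 0) :
    v = 0 := by
  obtain ⟨x, rfl⟩ := hv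
  rw [ContinuousLinearMap.coe_coe] at h ⊢
  rw [← norm_eq_zero, ← sq_eq_zero_iff, ← real_inner_self_eq_norm_sq,
    ← ContinuousLinearMap.adjoint_inner_left, h, inner_zero_left]

theorem PosDef.injective {B : E →L[ℝ] E} (hB : PosDef B) : Function.Injective B := by
  rw [injective_iff_map_eq_zero]
  intro x hx
  by_contra h0
  have := hB.2 x h0
  rw [hx, inner_zero_right] at this
  exact lt_irrefl _ this

theorem PosDef.isInvertible {B : E →L[ℝ] E} (hB : PosDef B) : B.IsInvertible :=
  ⟨(LinearEquiv.ofInjectiveEndo (B : E →ₗ[ℝ] E) hB.injective).toContinuousLinearEquiv, by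
    ext x; rfl⟩

end Operators

/-- The arithmetic behind the contraction factor: all constants are independent of `K`. -/
theorem contraction_factor {a K d c η : ℝ} (hK : 0 < K) (ha : 0 ≤ a) (hd : 0 ≤ d) (hc : 0 ≤ c)
    (hη : 0 ≤ η) (hdec : a ^ 2 + d ≤ 1 + c * η) (hres : a ≤ K * (√d + c * η)) :
    a ≤ √(K ^ 2 / (1 + K ^ 2)) + 2 * c * η := by
  have hcη : 0 ≤ c * η := mul_nonneg hc hη
  set t := √(K ^ 2 / (1 + K ^ 2)) with ht
  have ht2 : t ^ 2 = K ^ 2 / (1 + K ^ 2) := Real.sq_sqrt (by positivity)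
  have ht0 : 0 < t := Real.sqrt_pos.mpr (by positivity)
  have ht1 : t ≤ 1 := by
    rw [ht, Real.sqrt_le_iff, one_pow, div_le_one (by positivity)]
    exact ⟨zero_le_one, by linarith⟩
  set s := √d
  have hs2 : s ^ 2 = d := Real.sq_sqrt hd
  have hs0 : 0 ≤ s := Real.sqrt_nonneg d
  have h1 : a ^ 2 + s ^ 2 ≤ (1 + c * η) ^ 2 := by nlinarith
  have h2 : a ^ 2 * (1 + K ^ 2) ≤ K ^ 2 * (1 + 2 * (c * η)) ^ 2 := by
    have h3 : a ^ 2 ≤ K ^ 2 * (s + c * η) ^ 2 := by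
      rw [← mul_pow]; exact pow_le_pow_left₀ ha hres 2
    have h4 : s ≤ 1 + c * η := by nlinarith
    -- In the form that pairs with `h3`: a² ≤ K²((1 + 2cη)² - a²), hence a ≤ t(1 + 2cη), and t ≤ 1
    -- moves the perturbation outside t.
    have h5 : a ^ 2 + (s + c * η) ^ 2 ≤ (1 + 2 * (c * η)) ^ 2 := by nlinarith
    nlinarith [sq_nonneg K]
  have h6 : a ^ 2 ≤ (t * (1 + 2 * (c * η))) ^ 2 := by
    rw [mul_pow, ht2, div_mul_eq_mul_div, le_div_iff₀ (by positivity)]; exact h2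
  have h7 := (pow_le_pow_iff_left₀ ha (by positivity) two_ne_zero).mp h6
  nlinarith

end SGSADMM

namespace SGSADMM

/-! ### Block vectors, block-diagonal and triangular parts -/

section BlockCalculus

variable {s : ℕ} {Y : Fin s → Type*} [∀ i, NormedAddCommGroup (Y i)]
  [∀ i, InnerProductSpace ℝ (Y i)] [∀ i, FiniteDimensional ℝ (Y i)]

theorem blkIncl_apply_same (i : Fin s) (t : Y i) : (blkIncl i t : PiLp 2 Y) i = t := by
  simp [blkIncl]

theorem blkIncl_apply_ne {i j : Fin s} (h : j ≠ i) (t : Y i) : (blkIncl i t : PiLp 2 Y) j = 0 := by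
  simp [blkIncl, h]

theorem blkProj_apply (i : Fin s) (y : PiLp 2 Y) : blkProj i y = y i := rfl

theorem inner_blkIncl (i : Fin s) (t : Y i) (y : PiLp 2 Y) : ⟪blkIncl i t, y⟫_ℝ = ⟪t, y i⟫_ℝ := by
  rw [PiLp.inner_apply, Finset.sum_eq_single i, blkIncl_apply_same]
  · intro j _ hj; rw [blkIncl_apply_ne hj, inner_zero_left]
  · simp

theorem inner_blkIncl_right (i : Fin s) (t : Y i) (y : PiLp 2 Y) :
    ⟪y, blkIncl i t⟫_ℝ = ⟪y i, t⟫_ℝ := by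
  rw [real_inner_comm, inner_blkIncl, real_inner_comm]

theorem sum_blkIncl (y : PiLp 2 Y) : ∑ i, blkIncl i (y i) = y := by
  ext j
  rw [WithLp.ofLp_sum, Finset.sum_apply, Finset.sum_eq_single j]
  · exact blkIncl_apply_same j _
  · intro i _ hi; exact blkIncl_apply_ne hi.symm _
  · simp

theorem apply_eq_sum_block (T : PiLp 2 Y →L[ℝ] PiLp 2 Y) (y : PiLp 2 Y) (i : Fin s) :
    T y i = ∑ j, block T i j (y j) := by
  conv_lhs => rw [← sum_blkIncl y, map_sum, WithLp.ofLp_sum, Finset.sum_apply]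
  rfl

theorem blockDiag_apply (B : ∀ i, Y i →L[ℝ] Y i) (y : PiLp 2 Y) (i : Fin s) :
    blockDiag B y i = B i (y i) := by
  simp only [blockDiag, _root_.sum_apply, ContinuousLinearMap.comp_apply,
    blkProj_apply]
  rw [WithLp.ofLp_sum, Finset.sum_apply, Finset.sum_eq_single i]
  · exact blkIncl_apply_same i _
  · intro j _ hj; exact blkIncl_apply_ne hj.symm _
  · simp

theorem blockUpper_apply (T : PiLp 2 Y →L[ℝ] PiLp 2 Y) (y : PiLp 2 Y) (i : Fin s) :
    blockUpper T y i = ∑ j ∈ Finset.Ioi i, block T i j (y j) := by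
  simp only [blockUpper, _root_.sum_apply, ContinuousLinearMap.comp_apply,
    blkProj_apply]
  rw [WithLp.ofLp_sum, Finset.sum_apply, Finset.sum_eq_single i]
  · rw [WithLp.ofLp_sum, Finset.sum_apply]
    exact Finset.sum_congr rfl fun j _ => blkIncl_apply_same i _
  · intro j _ hj
    rw [WithLp.ofLp_sum, Finset.sum_apply]
    exact Finset.sum_eq_zero fun l _ => blkIncl_apply_ne hj.symm _
  · simp

theorem inner_block {T : PiLp 2 Y →L[ℝ] PiLp 2 Y} (hT : IsSelfAdjoint T) (i j : Fin s)
    (u : Y j) (v : Y i) : ⟪block T i j u, v⟫_ℝ = ⟪u, block T j i v⟫_ℝ := by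
  have h : ⟪T (blkIncl j u), blkIncl i v⟫_ℝ = ⟪blkIncl j u, T (blkIncl i v)⟫_ℝ :=
    ContinuousLinearMap.isSelfAdjoint_iff_isSymmetric.mp hT _ _
  rw [inner_blkIncl_right, inner_blkIncl] at h
  exact h

theorem inner_block_self (T : PiLp 2 Y →L[ℝ] PiLp 2 Y) (i : Fin s) (t : Y i) :
    ⟪t, block T i i t⟫_ℝ = ⟪blkIncl i t, T (blkIncl i t)⟫_ℝ := by
  rw [inner_blkIncl]; rfl

theorem adjoint_blockUpper_apply {T : PiLp 2 Y →L[ℝ] PiLp 2 Y} (hT : IsSelfAdjoint T)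
    (y : PiLp 2 Y) (i : Fin s) :
    ContinuousLinearMap.adjoint (blockUpper T) y i = ∑ j ∈ Finset.Iio i, block T i j (y j) := by
  refine ext_inner_right ℝ fun t => ?_
  rw [← inner_blkIncl_right, ContinuousLinearMap.adjoint_inner_left, PiLp.inner_apply, sum_inner]
  have h1 : ∀ k, ⟪y k, blockUpper T (blkIncl i t) k⟫_ℝ
      = if k < i then ⟪block T i k (y k), t⟫_ℝ else 0 := by
    intro k
    rw [blockUpper_apply]
    split_ifs with hk
    · rw [Finset.sum_eq_single i, blkIncl_apply_same, inner_block hT]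
      · intro j _ hj; rw [blkIncl_apply_ne hj, map_zero]
      · intro h; exact absurd (Finset.mem_Ioi.mpr hk) h
    · rw [Finset.sum_eq_zero, inner_zero_right]
      intro j hj
      rw [blkIncl_apply_ne, map_zero]
      rintro rfl
      exact hk (Finset.mem_Ioi.mp hj)
  simp_rw [h1]
  rw [← Finset.sum_filter]
  congr 1
  ext k; simp

theorem sum_split_at {M : Type*} [AddCommMonoid M] (i : Fin s) (g : Fin s → M) :
    ∑ j, g j = g i + ∑ j ∈ Finset.Iio i, g j + ∑ j ∈ Finset.Ioi i, g j := by
  have h : (Finset.univ : Finset (Fin s)) = ({i} ∪ Finset.Iio i) ∪ Finset.Ioi i := by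
    ext j; simp only [Finset.mem_univ, Finset.mem_union, Finset.mem_singleton, Finset.mem_Iio,
      Finset.mem_Ioi, true_iff]
    rcases lt_trichotomy j i with h | h | h <;> simp [h]
  rw [h, Finset.sum_union, Finset.sum_union, Finset.sum_singleton]
  · simp
  · rw [Finset.disjoint_left]
    intro j hj hj'
    simp only [Finset.mem_union, Finset.mem_singleton, Finset.mem_Iio, Finset.mem_Ioi] at hj hj'
    rcases hj with h | h
    · exact absurd hj' (by simp [h])
    · exact absurd hj' (not_lt.mpr h.le)

/-- The `i`-th component of `T e` in terms of the diagonal and the triangular parts of `T`. -/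
theorem apply_eq_diag_add_triangular {T : PiLp 2 Y →L[ℝ] PiLp 2 Y} (hT : IsSelfAdjoint T)
    {e a b c : PiLp 2 Y} {i : Fin s} (ha : ∀ j < i, e j = a j) (hb : ∀ j, i < j → e j = b j)
    (hc : e i = c i) :
    T e i = blockDiag (fun i => block T i i) c i
      + ContinuousLinearMap.adjoint (blockUpper T) a i + blockUpper T b i := by
  rw [apply_eq_sum_block, sum_split_at i, blockDiag_apply, adjoint_blockUpper_apply hT,
    blockUpper_apply, hc]
  congr 1
  · congr 1
    exact Finset.sum_congr rfl fun j hj => by rw [ha j (Finset.mem_Iio.mp hj)]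
  · exact Finset.sum_congr rfl fun j hj => by rw [hb j (Finset.mem_Ioi.mp hj)]

theorem eq_diag_add_triangular {T : PiLp 2 Y →L[ℝ] PiLp 2 Y} (hT : IsSelfAdjoint T)
    (e : PiLp 2 Y) :
    T e = blockDiag (fun i => block T i i) e
      + ContinuousLinearMap.adjoint (blockUpper T) e + blockUpper T e := by
  ext i
  exact apply_eq_diag_add_triangular hT (fun _ _ => rfl) (fun _ _ => rfl) rfl

theorem inner_blockDiag (B : ∀ i, Y i →L[ℝ] Y i) (u v : PiLp 2 Y) :
    ⟪u, blockDiag B v⟫_ℝ = ∑ i, ⟪u i, B i (v i)⟫_ℝ := by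
  rw [PiLp.inner_apply]
  exact Finset.sum_congr rfl fun i _ => by rw [blockDiag_apply]

theorem isSelfAdjoint_blockDiag {B : ∀ i, Y i →L[ℝ] Y i} (hB : ∀ i, IsSelfAdjoint (B i)) :
    IsSelfAdjoint (blockDiag B) := by
  rw [ContinuousLinearMap.isSelfAdjoint_iff_isSymmetric]
  intro u v
  simp only [ContinuousLinearMap.coe_coe]
  rw [real_inner_comm, inner_blockDiag, inner_blockDiag]
  refine Finset.sum_congr rfl fun i _ => ?_
  rw [real_inner_comm]
  exact ContinuousLinearMap.isSelfAdjoint_iff_isSymmetric.mp (hB i) _ _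

theorem PosDef.blockDiag {B : ∀ i, Y i →L[ℝ] Y i} (hB : ∀ i, PosDef (B i)) :
    PosDef (blockDiag B) := by
  refine ⟨isSelfAdjoint_blockDiag fun i => (hB i).1, fun y hy => ?_⟩
  rw [inner_blockDiag]
  have h0 : ∀ i, 0 ≤ ⟪y i, B i (y i)⟫_ℝ := fun i => by
    by_cases h : y i = 0
    · simp [h]
    · exact ((hB i).2 _ h).le
  obtain ⟨i, hi⟩ : ∃ i, y i ≠ 0 := by
    by_contra! h
    exact hy (by ext i; exact h i)
  exact Finset.sum_pos' (fun i _ => h0 i) ⟨i, Finset.mem_univ i, (hB i).2 _ hi⟩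

theorem norm_le_of_forall_blk_le {y : PiLp 2 Y} {M : ℝ} (hM : 0 ≤ M) (h : ∀ i, ‖y i‖ ≤ M) :
    ‖y‖ ≤ √s * M := by
  rw [PiLp.norm_eq_of_L2]
  calc √(∑ i, ‖y i‖ ^ 2) ≤ √(∑ _i : Fin s, M ^ 2) := by
        gcongr with i; exact h i
    _ = √s * M := by simp [Real.sqrt_mul, Real.sqrt_sq hM]

end BlockCalculus

/-! ### Positivity of 𝒩, 𝒩_d and 𝒩_sGS -/

namespace Data

variable {X : Type*} {s : ℕ} [NeZero s] {Y : Fin s → Type*} {Z : Type*}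
  [NormedAddCommGroup X] [InnerProductSpace ℝ X] [FiniteDimensional ℝ X]
  [∀ i, NormedAddCommGroup (Y i)] [∀ i, InnerProductSpace ℝ (Y i)]
  [∀ i, FiniteDimensional ℝ (Y i)]
  [NormedAddCommGroup Z] [InnerProductSpace ℝ Z] [FiniteDimensional ℝ Z]
  {P : Data X Y Z}

theorem Standing.inner_Sig_comm (hP : P.Standing) (u v : PiLp 2 Y) :
    ⟪P.Sig u, v⟫_ℝ = ⟪u, P.Sig v⟫_ℝ := hP.sig_pos.1 u v

theorem Standing.inner_Sig_nonneg (hP : P.Standing) (y : PiLp 2 Y) : 0 ≤ ⟪y, P.Sig y⟫_ℝ :=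
  hP.sig_pos.inner_nonneg_right y

theorem ProxCond.isSelfAdjoint_Dop (hD : P.ProxCond) : IsSelfAdjoint P.Dop :=
  isSelfAdjoint_blockDiag hD.selfAdjoint

theorem Nop_apply (y : PiLp 2 Y) : P.Nop y
    = P.Sig y + P.σ • P.F (ContinuousLinearMap.adjoint P.F y) + P.Dop y := by
  simp [Nop]

theorem isSelfAdjoint_Nop (hP : P.Standing) (hD : P.ProxCond) : IsSelfAdjoint P.Nop := by
  rw [ContinuousLinearMap.isSelfAdjoint_iff_isSymmetric]
  intro u v
  have h : ⟪P.Dop u, v⟫_ℝ = ⟪u, P.Dop v⟫_ℝ :=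
    ContinuousLinearMap.isSelfAdjoint_iff_isSymmetric.mp hD.isSelfAdjoint_Dop _ _
  simp only [ContinuousLinearMap.coe_coe, Nop_apply, inner_add_left, inner_add_right,
    real_inner_smul_left, real_inner_smul_right, h, hP.inner_Sig_comm]
  rw [← ContinuousLinearMap.adjoint_inner_right, ContinuousLinearMap.adjoint_inner_left]

theorem inner_Nop (y : PiLp 2 Y) : ⟪y, P.Nop y⟫_ℝ = ⟪y, P.Sig y⟫_ℝ
    + P.σ * ‖ContinuousLinearMap.adjoint P.F y‖ ^ 2 + ⟪y, P.Dop y⟫_ℝ := by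
  rw [Nop_apply, inner_add_right, inner_add_right, inner_smul_right,
    ← ContinuousLinearMap.adjoint_inner_left P.F, real_inner_self_eq_norm_sq]

theorem inner_Dop_blkIncl (i : Fin s) (t : Y i) :
    ⟪blkIncl i t, P.Dop (blkIncl i t)⟫_ℝ = ⟪t, P.D i t⟫_ℝ := by
  rw [inner_blkIncl, Dop, blockDiag_apply, blkIncl_apply_same]

theorem adjoint_blkProj_comp (i : Fin s) (t : Y i) :
    ContinuousLinearMap.adjoint (blkProj i ∘L P.F) t
      = ContinuousLinearMap.adjoint P.F (blkIncl i t) := by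
  refine ext_inner_right ℝ fun v => ?_
  rw [ContinuousLinearMap.adjoint_inner_left, ContinuousLinearMap.adjoint_inner_left,
    inner_blkIncl]
  rfl

theorem ProxCond.blk_pos (hD : P.ProxCond) (i : Fin s) {t : Y i} (ht : t ≠ 0) :
    0 < 1 / 2 * ⟪blkIncl i t, P.Sig (blkIncl i t)⟫_ℝ
      + P.σ * ‖ContinuousLinearMap.adjoint P.F (blkIncl i t)‖ ^ 2 + ⟪t, P.D i t⟫_ℝ := by
  have h := (hD.posDef i).2 t ht
  simp only [_root_.add_apply, _root_.smul_apply, inner_add_right,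
    inner_smul_right, inner_block_self] at h
  rw [ContinuousLinearMap.comp_apply,
    ← ContinuousLinearMap.adjoint_inner_left (blkProj i ∘L P.F), adjoint_blkProj_comp, real_inner_self_eq_norm_sq] at h
  exact h

theorem ProxCond.lower_nonneg (hD : P.ProxCond) (y : PiLp 2 Y) :
    0 ≤ ⟪y, P.Dop y⟫_ℝ + 1 / 2 * ⟪y, P.Sig y⟫_ℝ := by
  have h := hD.lower.inner_nonneg_right y
  simpa only [_root_.add_apply, _root_.smul_apply, inner_add_right,
    inner_smul_right] using h

theorem inner_block_Nop (i : Fin s) (t : Y i) : ⟪t, block P.Nop i i t⟫_ℝ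
    = ⟪blkIncl i t, P.Sig (blkIncl i t)⟫_ℝ
      + P.σ * ‖ContinuousLinearMap.adjoint P.F (blkIncl i t)‖ ^ 2 + ⟪t, P.D i t⟫_ℝ := by
  rw [inner_block_self, inner_Nop, inner_Dop_blkIncl]

theorem posDef_block_Nop (hP : P.Standing) (hD : P.ProxCond) (i : Fin s) :
    PosDef (block P.Nop i i) := by
  refine ⟨?_, fun t ht => ?_⟩
  · rw [ContinuousLinearMap.isSelfAdjoint_iff_isSymmetric]
    intro u v
    exact inner_block (isSelfAdjoint_Nop hP hD) i i u v
  · rw [inner_block_Nop]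
    have := hD.blk_pos i ht
    have := hP.inner_Sig_nonneg (blkIncl i t)
    linarith

theorem posDef_Nd (hP : P.Standing) (hD : P.ProxCond) : PosDef P.Nd :=
  PosDef.blockDiag fun i => posDef_block_Nop hP hD i

/-- `ContinuousLinearMap.inverse` has a default value at noninvertible maps; positive definiteness
of 𝒩_d ensures that it is a genuine inverse here. -/
theorem Nd_inverse_apply (hP : P.Standing) (hD : P.ProxCond) (y : PiLp 2 Y) :
    P.Nd (ContinuousLinearMap.inverse P.Nd y) = y :=
  (posDef_Nd hP hD).isInvertible.self_apply_inverse y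

theorem inner_Nd_inverse_comm (hP : P.Standing) (hD : P.ProxCond) (u v : PiLp 2 Y) :
    ⟪ContinuousLinearMap.inverse P.Nd u, v⟫_ℝ = ⟪u, ContinuousLinearMap.inverse P.Nd v⟫_ℝ := by
  have h : ∀ a b, ⟪P.Nd a, b⟫_ℝ = ⟪a, P.Nd b⟫_ℝ :=
    ContinuousLinearMap.isSelfAdjoint_iff_isSymmetric.mp (posDef_Nd hP hD).1
  conv_lhs => rw [← Nd_inverse_apply hP hD v]
  rw [← h, Nd_inverse_apply hP hD]

theorem inner_Nsgs_comm (hP : P.Standing) (hD : P.ProxCond) (u v : PiLp 2 Y) :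
    ⟪P.Nsgs u, v⟫_ℝ = ⟪u, P.Nsgs v⟫_ℝ := by
  simp only [Nsgs, ContinuousLinearMap.comp_apply]
  rw [← ContinuousLinearMap.adjoint_inner_right, inner_Nd_inverse_comm hP hD,
    ContinuousLinearMap.adjoint_inner_left]

theorem inner_Nsgs_eq (hP : P.Standing) (hD : P.ProxCond) (y : PiLp 2 Y) :
    ⟪y, P.Nsgs y⟫_ℝ =
      ⟪ContinuousLinearMap.inverse P.Nd (ContinuousLinearMap.adjoint P.Nu y),
        P.Nd (ContinuousLinearMap.inverse P.Nd (ContinuousLinearMap.adjoint P.Nu y))⟫_ℝ := by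
  rw [Nd_inverse_apply hP hD]
  simp only [Nsgs, ContinuousLinearMap.comp_apply]
  rw [← ContinuousLinearMap.adjoint_inner_left, real_inner_comm]

theorem _root_.SGSADMM.PosDef.inner_nonneg {E : Type*} [NormedAddCommGroup E] [InnerProductSpace ℝ E]
    [FiniteDimensional ℝ E] {B : E →L[ℝ] E} (hB : PosDef B) (x : E) : 0 ≤ ⟪x, B x⟫_ℝ := by
  by_cases h : x = 0
  · simp [h]
  · exact (hB.2 x h).le

theorem inner_Nsgs_nonneg (hP : P.Standing) (hD : P.ProxCond) (y : PiLp 2 Y) :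
    0 ≤ ⟪y, P.Nsgs y⟫_ℝ := by
  rw [inner_Nsgs_eq hP hD]
  exact (posDef_Nd hP hD).inner_nonneg _

theorem adjoint_Nu_eq_zero (hP : P.Standing) (hD : P.ProxCond) {y : PiLp 2 Y}
    (h : ⟪y, P.Nsgs y⟫_ℝ = 0) : ContinuousLinearMap.adjoint P.Nu y = 0 := by
  rw [inner_Nsgs_eq hP hD] at h
  have h1 : ContinuousLinearMap.inverse P.Nd (ContinuousLinearMap.adjoint P.Nu y) = 0 := by
    by_contra hne
    exact ((posDef_Nd hP hD).2 _ hne).ne' h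
  rw [← Nd_inverse_apply hP hD (ContinuousLinearMap.adjoint P.Nu y), h1, map_zero]

/-- When 𝒩_u*y = 0 the off-diagonal blocks drop out of ⟪y, 𝒩y⟫, and the other two hypotheses turn
this into ⟪y, (𝒩_d + 𝒟)y⟫ = 0. That form is a sum over blocks of (½Σ̂ᵢᵢ + σFᵢFᵢ* + 𝒟ᵢ) + (½Σ̂ᵢᵢ +
𝒟ᵢ), positive definite plus positive semidefinite, so every block of y vanishes. This is where
definiteness of the individual blocks yields definiteness on all of Y. -/
theorem eq_zero_of_forms_eq_zero (hP : P.Standing) (hD : P.ProxCond) {y : PiLp 2 Y}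
    (h1 : ⟪y, P.Dop y⟫_ℝ + 1 / 2 * ⟪y, P.Sig y⟫_ℝ = 0)
    (h2 : ContinuousLinearMap.adjoint P.F y = 0)
    (h3 : ContinuousLinearMap.adjoint P.Nu y = 0) : y = 0 := by
  have hN := inner_Nop (P := P) y
  have hN' : P.Nop y = P.Nd y + ContinuousLinearMap.adjoint P.Nu y + P.Nu y :=
    eq_diag_add_triangular (isSelfAdjoint_Nop hP hD) y
  rw [hN', h3, add_zero, inner_add_right, ← ContinuousLinearMap.adjoint_inner_left P.Nu, h3,
    inner_zero_left, h2, norm_zero] at hN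
  have hNd : ⟪y, P.Nd y⟫_ℝ = ∑ i, ⟪y i, block P.Nop i i (y i)⟫_ℝ := inner_blockDiag _ y y
  have hDo : ⟪y, P.Dop y⟫_ℝ = ∑ i, ⟪y i, P.D i (y i)⟫_ℝ := inner_blockDiag _ y y
  have hsum : ∑ i, (⟪y i, block P.Nop i i (y i)⟫_ℝ + ⟪y i, P.D i (y i)⟫_ℝ) = 0 := by
    rw [Finset.sum_add_distrib, ← hNd, ← hDo]
    linarith
  have hlow : ∀ i, 0 ≤ ⟪y i, P.D i (y i)⟫_ℝ
      + 1 / 2 * ⟪blkIncl i (y i), P.Sig (blkIncl i (y i))⟫_ℝ := fun i => by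
    rw [← inner_Dop_blkIncl]; exact hD.lower_nonneg _
  have hF : ∀ i, 0 ≤ P.σ * ‖ContinuousLinearMap.adjoint P.F (blkIncl i (y i))‖ ^ 2 := fun i =>
    mul_nonneg hP.σ_pos.le (sq_nonneg _)
  rw [Finset.sum_eq_zero_iff_of_nonneg] at hsum
  · ext i
    by_contra hne
    have e1 := hsum i (Finset.mem_univ i)
    have e2 := hD.blk_pos i hne
    rw [inner_block_Nop] at e1
    linarith [hlow i, hF i]
  · intro i _
    rw [inner_block_Nop]
    linarith [hlow i, hF i]

end Data
end SGSADMM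

/-! ### The operators 𝒯, Θ, Ξ and the seminorm of Ω -/

namespace SGSADMM
namespace Data

variable {X : Type*} {s : ℕ} [NeZero s] {Y : Fin s → Type*} {Z : Type*}
  [NormedAddCommGroup X] [InnerProductSpace ℝ X] [FiniteDimensional ℝ X]
  [∀ i, NormedAddCommGroup (Y i)] [∀ i, InnerProductSpace ℝ (Y i)]
  [∀ i, FiniteDimensional ℝ (Y i)]
  [NormedAddCommGroup Z] [InnerProductSpace ℝ Z] [FiniteDimensional ℝ Z]
  {P : Data X Y Z}

/-- The operator `σ F G* [G G*]† G F*`. -/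
noncomputable def Sg (P : Data X Y Z) : PiLp 2 Y →L[ℝ] PiLp 2 Y :=
  P.σ • (P.F ∘L ContinuousLinearMap.adjoint P.G ∘L
    pinv (P.G ∘L ContinuousLinearMap.adjoint P.G) ∘L P.G ∘L ContinuousLinearMap.adjoint P.F)

/-- The `Y`-part of `𝒯`. -/
noncomputable def Ty (P : Data X Y Z) : PiLp 2 Y →L[ℝ] PiLp 2 Y := P.Dop + P.Nsgs + P.Sg

/-- The `Y`-part of `𝒫 + 𝒯`. -/
noncomputable def Sop (P : Data X Y Z) : PiLp 2 Y →L[ℝ] PiLp 2 Y := P.Sig + P.Ty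

theorem Sg_apply (y : PiLp 2 Y) : P.Sg y = P.σ • P.F (ContinuousLinearMap.adjoint P.G
    (pinv (P.G ∘L ContinuousLinearMap.adjoint P.G)
      (P.G (ContinuousLinearMap.adjoint P.F y)))) := rfl

theorem inner_Sg (y : PiLp 2 Y) : ⟪y, P.Sg y⟫_ℝ = P.σ * ‖ContinuousLinearMap.adjoint P.G
    (pinv (P.G ∘L ContinuousLinearMap.adjoint P.G)
      (P.G (ContinuousLinearMap.adjoint P.F y)))‖ ^ 2 := by
  rw [Sg_apply, real_inner_smul_right, ← ContinuousLinearMap.adjoint_inner_left P.F,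
    ContinuousLinearMap.adjoint_inner_right P.G, inner_pinv_gram]

theorem inner_Sg_comm (u v : PiLp 2 Y) : ⟪P.Sg u, v⟫_ℝ = ⟪u, P.Sg v⟫_ℝ := by
  rw [Sg_apply, Sg_apply, real_inner_smul_right, real_inner_smul_left,
    ← ContinuousLinearMap.adjoint_inner_left P.F, ← ContinuousLinearMap.adjoint_inner_right P.F,
    ContinuousLinearMap.adjoint_inner_right P.G, ContinuousLinearMap.adjoint_inner_left P.G,
    inner_pinv_symm (isSelfAdjoint_comp_adjoint P.G)]

theorem inner_Ty (y : PiLp 2 Y) :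
    ⟪y, P.Ty y⟫_ℝ = ⟪y, P.Dop y⟫_ℝ + ⟪y, P.Nsgs y⟫_ℝ + ⟪y, P.Sg y⟫_ℝ := by
  simp only [Ty, _root_.add_apply, inner_add_right]

theorem inner_Ty_comm (hP : P.Standing) (hD : P.ProxCond) (u v : PiLp 2 Y) :
    ⟪P.Ty u, v⟫_ℝ = ⟪u, P.Ty v⟫_ℝ := by
  have h : ⟪P.Dop u, v⟫_ℝ = ⟪u, P.Dop v⟫_ℝ :=
    ContinuousLinearMap.isSelfAdjoint_iff_isSymmetric.mp hD.isSelfAdjoint_Dop _ _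
  simp only [Ty, _root_.add_apply, inner_add_right, inner_add_left, h,
    inner_Nsgs_comm hP hD, inner_Sg_comm]

theorem inner_Sg_nonneg (hP : P.Standing) (y : PiLp 2 Y) : 0 ≤ ⟪y, P.Sg y⟫_ℝ := by
  rw [inner_Sg]; exact mul_nonneg hP.σ_pos.le (sq_nonneg _)

theorem half_Sig_add_Ty_nonneg (hP : P.Standing) (hD : P.ProxCond) (y : PiLp 2 Y) :
    0 ≤ 1 / 2 * ⟪y, P.Sig y⟫_ℝ + ⟪y, P.Ty y⟫_ℝ := by
  rw [inner_Ty]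
  linarith [hD.lower_nonneg y, inner_Nsgs_nonneg hP hD y, inner_Sg_nonneg hP y]

theorem Sop_apply (y : PiLp 2 Y) : P.Sop y = P.Sig y + P.Ty y := rfl

theorem inner_Sop (y : PiLp 2 Y) : ⟪y, P.Sop y⟫_ℝ = ⟪y, P.Sig y⟫_ℝ + ⟪y, P.Ty y⟫_ℝ := by
  rw [Sop_apply, inner_add_right]

theorem inner_Sop_comm (hP : P.Standing) (hD : P.ProxCond) (u v : PiLp 2 Y) :
    ⟪P.Sop u, v⟫_ℝ = ⟪u, P.Sop v⟫_ℝ := by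
  rw [Sop_apply, Sop_apply, inner_add_left, inner_add_right, hP.inner_Sig_comm,
    inner_Ty_comm hP hD]

/-! ### The operators on `Y × Z` -/

theorem extendY_fst (O : PiLp 2 Y →L[ℝ] PiLp 2 Y) (w : WithLp 2 (PiLp 2 Y × Z)) :
    (extendY O w).fst = O w.fst := rfl

theorem extendY_snd (O : PiLp 2 Y →L[ℝ] PiLp 2 Y) (w : WithLp 2 (PiLp 2 Y × Z)) :
    (extendY O w).snd = 0 := rfl

theorem inner_prod {V W : Type*} [NormedAddCommGroup V] [InnerProductSpace ℝ V]
    [NormedAddCommGroup W] [InnerProductSpace ℝ W] (a b : WithLp 2 (V × W)) :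
    ⟪a, b⟫_ℝ = ⟪a.fst, b.fst⟫_ℝ + ⟪a.snd, b.snd⟫_ℝ := WithLp.prod_inner_apply a b

theorem inner_extendY (O : PiLp 2 Y →L[ℝ] PiLp 2 Y) (w w' : WithLp 2 (PiLp 2 Y × Z)) :
    ⟪w, extendY O w'⟫_ℝ = ⟪w.fst, O w'.fst⟫_ℝ := by
  rw [inner_prod, extendY_fst, extendY_snd, inner_zero_right, add_zero]

theorem Aop_fst (x : X) : (P.Aop x).fst = P.F x := rfl

theorem Aop_snd (x : X) : (P.Aop x).snd = P.G x := rfl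

theorem adjoint_Aop_apply (w : WithLp 2 (PiLp 2 Y × Z)) : ContinuousLinearMap.adjoint P.Aop w
    = ContinuousLinearMap.adjoint P.F w.fst + ContinuousLinearMap.adjoint P.G w.snd := by
  refine ext_inner_right ℝ fun x => ?_
  rw [ContinuousLinearMap.adjoint_inner_left, inner_prod, Aop_fst, Aop_snd, inner_add_left,
    ContinuousLinearMap.adjoint_inner_left, ContinuousLinearMap.adjoint_inner_left]

theorem inner_AAs (w w' : WithLp 2 (PiLp 2 Y × Z)) : ⟪w, P.AAs w'⟫_ℝ
    = ⟪ContinuousLinearMap.adjoint P.Aop w, ContinuousLinearMap.adjoint P.Aop w'⟫_ℝ := by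
  rw [AAs, ContinuousLinearMap.comp_apply, ContinuousLinearMap.adjoint_inner_left]

theorem Tcal_eq : P.Tcal = extendY P.Ty := rfl

theorem inner_Pop_add_Tcal (w w' : WithLp 2 (PiLp 2 Y × Z)) :
    ⟪w, (P.Pop + P.Tcal) w'⟫_ℝ = ⟪w.fst, P.Sop w'.fst⟫_ℝ := by
  rw [_root_.add_apply, inner_add_right, Tcal_eq, Pop, inner_extendY, inner_extendY, Sop_apply,
    inner_add_right]

theorem inner_Theta_bilin (w w' : WithLp 2 (PiLp 2 Y × Z)) : ⟪w, P.Theta w'⟫_ℝ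
    = P.τ * P.σ * (⟪w.fst, P.Sop w'.fst⟫_ℝ + (2 - P.τ) * P.σ / 3 *
      ⟪ContinuousLinearMap.adjoint P.Aop w, ContinuousLinearMap.adjoint P.Aop w'⟫_ℝ) := by
  rw [Theta, _root_.smul_apply, real_inner_smul_right, _root_.add_apply, inner_add_right,
    inner_Pop_add_Tcal, _root_.smul_apply, real_inner_smul_right, inner_AAs]

theorem inner_Xi_bilin (w w' : WithLp 2 (PiLp 2 Y × Z)) : ⟪w, P.Xi w'⟫_ℝ
    = P.τ * P.σ * (1 / 2 * ⟪w.fst, P.Sig w'.fst⟫_ℝ + ⟪w.fst, P.Ty w'.fst⟫_ℝ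
      + (2 - P.τ) * P.σ / 6 *
      ⟪ContinuousLinearMap.adjoint P.Aop w, ContinuousLinearMap.adjoint P.Aop w'⟫_ℝ) := by
  rw [Xi, _root_.smul_apply, real_inner_smul_right, _root_.add_apply, inner_add_right,
    _root_.add_apply, inner_add_right, _root_.smul_apply, real_inner_smul_right,
    _root_.smul_apply, real_inner_smul_right, inner_AAs, Pop, Tcal_eq, inner_extendY,
    inner_extendY]

theorem inner_Theta (w : WithLp 2 (PiLp 2 Y × Z)) : ⟪w, P.Theta w⟫_ℝ
    = P.τ * P.σ * (⟪w.fst, P.Sop w.fst⟫_ℝ + (2 - P.τ) * P.σ / 3 *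
      ‖ContinuousLinearMap.adjoint P.Aop w‖ ^ 2) := by
  rw [inner_Theta_bilin, real_inner_self_eq_norm_sq]

theorem inner_Xi (w : WithLp 2 (PiLp 2 Y × Z)) : ⟪w, P.Xi w⟫_ℝ
    = P.τ * P.σ * (1 / 2 * ⟪w.fst, P.Sig w.fst⟫_ℝ + ⟪w.fst, P.Ty w.fst⟫_ℝ
      + (2 - P.τ) * P.σ / 6 * ‖ContinuousLinearMap.adjoint P.Aop w‖ ^ 2) := by
  rw [inner_Xi_bilin, real_inner_self_eq_norm_sq]

theorem Standing.τσ_pos (hP : P.Standing) : 0 < P.τ * P.σ := mul_pos hP.τ_pos hP.σ_pos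

theorem Standing.penalty_pos (hP : P.Standing) : 0 < (2 - P.τ) * P.σ :=
  mul_pos (by linarith [hP.τ_lt]) hP.σ_pos

theorem inner_Xi_nonneg (hP : P.Standing) (hD : P.ProxCond) (w : WithLp 2 (PiLp 2 Y × Z)) :
    0 ≤ ⟪w, P.Xi w⟫_ℝ := by
  rw [inner_Xi]
  have := hP.penalty_pos
  have := half_Sig_add_Ty_nonneg hP hD w.fst
  exact mul_nonneg hP.τσ_pos.le (by positivity)

theorem inner_Xi_le_inner_Theta (hP : P.Standing) (w : WithLp 2 (PiLp 2 Y × Z)) :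
    ⟪w, P.Xi w⟫_ℝ ≤ ⟪w, P.Theta w⟫_ℝ := by
  rw [inner_Xi, inner_Theta, inner_Sop]
  have h1 := mul_nonneg hP.penalty_pos.le (sq_nonneg ‖ContinuousLinearMap.adjoint P.Aop w‖)
  have h2 := hP.inner_Sig_nonneg w.fst
  exact mul_le_mul_of_nonneg_left (by linarith) hP.τσ_pos.le

/-- The subspace `Y × Range G`. -/
noncomputable def reduced (P : Data X Y Z) : Submodule ℝ (WithLp 2 (PiLp 2 Y × Z)) :=
  (LinearMap.range (P.G : X →ₗ[ℝ] Z)).comap (WithLp.sndL 2 ℝ (PiLp 2 Y) Z : _ →ₗ[ℝ] Z)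

/-- A null vector kills every summand of the form. From 𝒜*w = 0, F*y lies in the range of G*; the
pseudoinverse term measures the projection of F*y onto that range, so F*y = 0. Then
`eq_zero_of_forms_eq_zero` gives y = 0, and G*z = 0 with z in the range of G gives z = 0. -/
theorem inner_Xi_pos (hP : P.Standing) (hD : P.ProxCond) {w : WithLp 2 (PiLp 2 Y × Z)}
    (hw : w ∈ P.reduced) (h0 : w ≠ 0) : 0 < ⟪w, P.Xi w⟫_ℝ := by
  refine (inner_Xi_nonneg hP hD w).lt_of_ne fun h => h0 ?_
  rw [inner_Xi, inner_Ty] at h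
  have h1 := hD.lower_nonneg w.fst
  have h2 := inner_Nsgs_nonneg hP hD w.fst
  have h3 := inner_Sg_nonneg hP w.fst
  have h4 := mul_nonneg hP.penalty_pos.le (sq_nonneg ‖ContinuousLinearMap.adjoint P.Aop w‖)
  have h5 := (mul_eq_zero.mp h.symm).resolve_left hP.τσ_pos.ne'
  have h6 : ‖ContinuousLinearMap.adjoint P.Aop w‖ ^ 2 = 0 :=
    (mul_eq_zero.mp (show (2 - P.τ) * P.σ * ‖ContinuousLinearMap.adjoint P.Aop w‖ ^ 2 = 0 by
      linarith)).resolve_left hP.penalty_pos.ne'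
  have h7 : ContinuousLinearMap.adjoint P.F w.fst
      = ContinuousLinearMap.adjoint P.G (-w.snd) := by
    rw [map_neg, eq_neg_iff_add_eq_zero, ← adjoint_Aop_apply]
    exact norm_eq_zero.mp (sq_eq_zero_iff.mp h6)
  have h8 : ContinuousLinearMap.adjoint P.F w.fst = 0 := by
    have e : ⟪w.fst, P.Sg w.fst⟫_ℝ = 0 := by linarith
    rw [inner_Sg, h7, adjoint_pinv_gram_apply, ← h7] at e
    exact norm_eq_zero.mp (sq_eq_zero_iff.mp ((mul_eq_zero.mp e).resolve_left hP.σ_pos.ne'))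
  have h9 : w.fst = 0 := eq_zero_of_forms_eq_zero hP hD (by linarith) h8
    (adjoint_Nu_eq_zero hP hD (by linarith))
  have h10 : w.snd = 0 := by
    refine eq_zero_of_mem_range_of_adjoint_eq_zero P.G hw ?_
    rw [h8, map_neg, eq_comm, neg_eq_zero] at h7
    exact h7
  rw [← norm_eq_zero, ← sq_eq_zero_iff, WithLp.prod_norm_sq_eq_of_L2, h9, h10]
  simp

theorem exists_inner_Xi_lower (hP : P.Standing) (hD : P.ProxCond) :
    ∃ m > 0, ∀ w ∈ P.reduced, m * ‖w‖ ^ 2 ≤ ⟪w, P.Xi w⟫_ℝ :=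
  exists_coercive_on (q := fun w => ⟪w, P.Xi w⟫_ℝ) (by fun_prop)
    (fun l v => by simp only [map_smul, real_inner_smul_left, real_inner_smul_right]; ring)
    P.reduced fun _ hv h0 => inner_Xi_pos hP hD hv h0

/-- `(y; z) ↦ (y; Π_{Range G} z)`. -/
noncomputable def reduce (P : Data X Y Z) (w : WithLp 2 (PiLp 2 Y × Z)) : WithLp 2 (PiLp 2 Y × Z) :=
  WithLp.toLp 2 (w.fst, projRange P.G w.snd)

theorem reduce_mem (w : WithLp 2 (PiLp 2 Y × Z)) : P.reduce w ∈ P.reduced :=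
  (LinearMap.range (P.G : X →ₗ[ℝ] Z)).starProjection_apply_mem w.snd

theorem adjoint_Aop_reduce (w : WithLp 2 (PiLp 2 Y × Z)) :
    ContinuousLinearMap.adjoint P.Aop (P.reduce w) = ContinuousLinearMap.adjoint P.Aop w := by
  rw [adjoint_Aop_apply, adjoint_Aop_apply]
  congr 1
  exact adjoint_projRange P.G w.snd

/-- Both forms see w only through y and 𝒜*w, so z may be projected onto the range of G, where Ξ is
coercive. This makes the set defining `zeta` nonempty, so that its infimum is meaningful. -/
theorem exists_Xi_dominates (hP : P.Standing) (hD : P.ProxCond) :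
    ∃ t > 0, ∀ w, ⟪w, P.Theta w⟫_ℝ ≤ t * ⟪w, P.Xi w⟫_ℝ := by
  obtain ⟨m, hm, h⟩ := exists_inner_Xi_lower hP hD
  refine ⟨‖P.Theta‖ / m + 1, by positivity, fun w => ?_⟩
  have e1 : ⟪w, P.Theta w⟫_ℝ = ⟪P.reduce w, P.Theta (P.reduce w)⟫_ℝ := by
    rw [inner_Theta, inner_Theta, adjoint_Aop_reduce]; rfl
  have e2 : ⟪w, P.Xi w⟫_ℝ = ⟪P.reduce w, P.Xi (P.reduce w)⟫_ℝ := by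
    rw [inner_Xi, inner_Xi, adjoint_Aop_reduce]; rfl
  rw [e1, e2]
  set v := P.reduce w
  have h1 := h v (reduce_mem w)
  have h2 : ⟪v, P.Theta v⟫_ℝ ≤ ‖P.Theta‖ * ‖v‖ ^ 2 := by
    calc ⟪v, P.Theta v⟫_ℝ ≤ ‖v‖ * ‖P.Theta v‖ := real_inner_le_norm _ _
      _ ≤ ‖v‖ * (‖P.Theta‖ * ‖v‖) := by gcongr; exact P.Theta.le_opNorm v
      _ = _ := by ring
  have h3 : ‖P.Theta‖ * ‖v‖ ^ 2 ≤ ‖P.Theta‖ / m * ⟪v, P.Xi v⟫_ℝ := by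
    rw [div_mul_eq_mul_div, le_div_iff₀ hm, mul_assoc]
    gcongr
    linarith
  have h4 := inner_Xi_nonneg hP hD v
  linarith

theorem inner_Theta_comm (hP : P.Standing) (hD : P.ProxCond) (w w' : WithLp 2 (PiLp 2 Y × Z)) :
    ⟪P.Theta w, w'⟫_ℝ = ⟪w, P.Theta w'⟫_ℝ := by
  rw [real_inner_comm, inner_Theta_bilin, inner_Theta_bilin, real_inner_comm,
    inner_Sop_comm hP hD, real_inner_comm (ContinuousLinearMap.adjoint P.Aop w)]

theorem inner_Xi_comm (hP : P.Standing) (hD : P.ProxCond) (w w' : WithLp 2 (PiLp 2 Y × Z)) :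
    ⟪P.Xi w, w'⟫_ℝ = ⟪w, P.Xi w'⟫_ℝ := by
  rw [real_inner_comm, inner_Xi_bilin, inner_Xi_bilin, real_inner_comm,
    hP.inner_Sig_comm, real_inner_comm (P.Ty w.fst), inner_Ty_comm hP hD,
    real_inner_comm (ContinuousLinearMap.adjoint P.Aop w)]

theorem inner_Theta_le_zeta (hP : P.Standing) (hD : P.ProxCond)
    (w : WithLp 2 (PiLp 2 Y × Z)) : ⟪w, P.Theta w⟫_ℝ ≤ P.zeta * ⟪w, P.Xi w⟫_ℝ := by
  have hne : {t : ℝ | 0 < t ∧ (t • P.Xi - P.Theta).IsPositive}.Nonempty := by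
    obtain ⟨t, ht, h⟩ := exists_Xi_dominates hP hD
    refine ⟨t, ht, ?_⟩
    rw [ContinuousLinearMap.isPositive_iff]
    refine ⟨fun u v => ?_, fun v => ?_⟩
    · simp only [ContinuousLinearMap.coe_coe, _root_.sub_apply, _root_.smul_apply,
        inner_sub_left, inner_sub_right, real_inner_smul_left, real_inner_smul_right,
        inner_Theta_comm hP hD, inner_Xi_comm hP hD]
    · rw [real_inner_comm, _root_.sub_apply, _root_.smul_apply, inner_sub_right,
        real_inner_smul_right]
      linarith [h v]
  have hall : ∀ t ∈ {t : ℝ | 0 < t ∧ (t • P.Xi - P.Theta).IsPositive},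
      ⟪w, P.Theta w⟫_ℝ ≤ t * ⟪w, P.Xi w⟫_ℝ := by
    intro t ht
    have := ht.2.inner_nonneg_right w
    rw [_root_.sub_apply, _root_.smul_apply, inner_sub_right, real_inner_smul_right] at this
    linarith
  -- The inequality passes to the infimum by dividing by the Ξ-form; where that form vanishes, any
  -- admissible t already forces the Θ-form to be nonpositive.
  rcases (inner_Xi_nonneg hP hD w).eq_or_lt with h0 | h0
  · obtain ⟨t, ht⟩ := hne
    have := hall t ht
    rw [← h0, mul_zero] at this ⊢
    exact this
  · rw [← div_le_iff₀ h0]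
    exact le_csInf hne fun t ht => by rw [div_le_iff₀ h0]; exact hall t ht

/-! ### The seminorm `‖·‖_Ω` -/

theorem inner_Omega (u : WithLp 2 (X × WithLp 2 (PiLp 2 Y × Z))) :
    ⟪u, P.Omega u⟫_ℝ = ‖u.fst‖ ^ 2 + ⟪u.snd, P.Theta u.snd⟫_ℝ := by
  rw [inner_prod, ← real_inner_self_eq_norm_sq]
  rfl

theorem inner_Theta_nonneg (hP : P.Standing) (hD : P.ProxCond) (w : WithLp 2 (PiLp 2 Y × Z)) :
    0 ≤ ⟪w, P.Theta w⟫_ℝ :=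
  (inner_Xi_nonneg hP hD w).trans (inner_Xi_le_inner_Theta hP w)

theorem opNorm_Omega_sq (hP : P.Standing) (hD : P.ProxCond)
    (u : WithLp 2 (X × WithLp 2 (PiLp 2 Y × Z))) :
    opNorm P.Omega u ^ 2 = ‖u.fst‖ ^ 2 + ⟪u.snd, P.Theta u.snd⟫_ℝ := by
  rw [opNorm, Real.sq_sqrt, inner_Omega]
  rw [inner_Omega]
  have := inner_Theta_nonneg hP hD u.snd
  positivity

theorem opNorm_Omega_le (u : WithLp 2 (X × WithLp 2 (PiLp 2 Y × Z))) :
    opNorm P.Omega u ≤ √(max ‖P.Theta‖ 1) * ‖u‖ := by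
  rw [← Real.sqrt_sq (norm_nonneg u), ← Real.sqrt_mul (by positivity), opNorm]
  refine Real.sqrt_le_sqrt ?_
  rw [inner_Omega, WithLp.prod_norm_sq_eq_of_L2, mul_add]
  have h2 : ⟪u.snd, P.Theta u.snd⟫_ℝ ≤ ‖P.Theta‖ * ‖u.snd‖ ^ 2 := by
    calc ⟪u.snd, P.Theta u.snd⟫_ℝ ≤ ‖u.snd‖ * ‖P.Theta u.snd‖ := real_inner_le_norm _ _
      _ ≤ ‖u.snd‖ * (‖P.Theta‖ * ‖u.snd‖) := by gcongr; exact P.Theta.le_opNorm _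
      _ = _ := by ring
  have h3 : ‖P.Theta‖ * ‖u.snd‖ ^ 2 ≤ max ‖P.Theta‖ 1 * ‖u.snd‖ ^ 2 := by
    gcongr; exact le_max_left _ _
  have h4 : 1 * ‖u.fst‖ ^ 2 ≤ max ‖P.Theta‖ 1 * ‖u.fst‖ ^ 2 := by
    gcongr; exact le_max_right _ _
  linarith

theorem exists_norm_le_opNorm (hP : P.Standing) (hD : P.ProxCond) :
    ∃ c > 0, ∀ u : WithLp 2 (X × WithLp 2 (PiLp 2 Y × Z)), u.snd ∈ P.reduced →
      ‖u‖ ≤ c * opNorm P.Omega u := by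
  obtain ⟨m, hm, h⟩ := exists_inner_Xi_lower hP hD
  refine ⟨√(1 / m + 1), by positivity, fun u hu => ?_⟩
  rw [← Real.sqrt_sq (norm_nonneg u), opNorm, ← Real.sqrt_mul (by positivity)]
  refine Real.sqrt_le_sqrt ?_
  rw [inner_Omega, WithLp.prod_norm_sq_eq_of_L2]
  have h1 := (h _ hu).trans (inner_Xi_le_inner_Theta hP u.snd)
  have h2 : ‖u.snd‖ ^ 2 ≤ 1 / m * ⟪u.snd, P.Theta u.snd⟫_ℝ := by
    rw [div_mul_eq_mul_div, le_div_iff₀ hm]; linarith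
  have h3 : 0 ≤ 1 / m * ‖u.fst‖ ^ 2 := by positivity
  have h4 := inner_Theta_nonneg hP hD u.snd
  linarith

theorem opNorm_Omega_reduce (u : WithLp 2 (X × WithLp 2 (PiLp 2 Y × Z)))
    (u' : WithLp 2 (X × WithLp 2 (PiLp 2 Y × Z))) (h1 : u.fst = u'.fst)
    (h2 : u.snd.fst = u'.snd.fst)
    (h3 : ContinuousLinearMap.adjoint P.Aop u.snd = ContinuousLinearMap.adjoint P.Aop u'.snd) :
    opNorm P.Omega u = opNorm P.Omega u' := by
  rw [opNorm, opNorm, inner_Omega, inner_Omega, inner_Theta, inner_Theta, h1, h2, h3]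

theorem opDist_nonneg {V : Type*} [NormedAddCommGroup V] [InnerProductSpace ℝ V]
    (O : V →L[ℝ] V) (v : V) (H : Set V) : 0 ≤ opDist O v H :=
  Real.sInf_nonneg (by rintro _ ⟨v', _, rfl⟩; exact Real.sqrt_nonneg _)

theorem opDist_le {V : Type*} [NormedAddCommGroup V] [InnerProductSpace ℝ V]
    (O : V →L[ℝ] V) (v : V) {H : Set V} {v' : V} (h : v' ∈ H) :
    opDist O v H ≤ opNorm O (v - v') :=
  csInf_le ⟨0, by rintro _ ⟨v', _, rfl⟩; exact Real.sqrt_nonneg _⟩ ⟨v', h, rfl⟩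

theorem opDist_Omega_le_infDist {H : Set (WithLp 2 (X × WithLp 2 (PiLp 2 Y × Z)))}
    (hH : H.Nonempty) (u : WithLp 2 (X × WithLp 2 (PiLp 2 Y × Z))) :
    opDist P.Omega u H ≤ √(max ‖P.Theta‖ 1) * Metric.infDist u H := by
  have hm : 0 < √(max ‖P.Theta‖ 1) := by positivity
  rw [← div_le_iff₀' hm, Metric.le_infDist hH]
  intro v hv
  rw [div_le_iff₀' hm, dist_eq_norm]
  exact (opDist_le _ _ hv).trans (opNorm_Omega_le _)

end Data
end SGSADMM

/-! ### From block subproblems to one proximal step -/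

namespace SGSADMM

theorem splice_same {s : ℕ} {Y : Fin s → Type*} [∀ i, NormedAddCommGroup (Y i)]
    [∀ i, InnerProductSpace ℝ (Y i)] [∀ i, FiniteDimensional ℝ (Y i)]
    (i : Fin s) (u v : PiLp 2 Y) (t : Y i) : splice i u t v i = t := by
  simp [splice]

theorem splice_lt {s : ℕ} {Y : Fin s → Type*} [∀ i, NormedAddCommGroup (Y i)]
    [∀ i, InnerProductSpace ℝ (Y i)] [∀ i, FiniteDimensional ℝ (Y i)]
    {i j : Fin s} (h : j < i) (u v : PiLp 2 Y) (t : Y i) : splice i u t v j = u j := by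
  simp [splice, h, h.ne]

theorem splice_gt {s : ℕ} {Y : Fin s → Type*} [∀ i, NormedAddCommGroup (Y i)]
    [∀ i, InnerProductSpace ℝ (Y i)] [∀ i, FiniteDimensional ℝ (Y i)]
    {i j : Fin s} (h : i < j) (u v : PiLp 2 Y) (t : Y i) : splice i u t v j = v j := by
  simp [splice, h.ne', h.not_gt]

theorem splice_add_smul {s : ℕ} {Y : Fin s → Type*} [∀ i, NormedAddCommGroup (Y i)]
    [∀ i, InnerProductSpace ℝ (Y i)] [∀ i, FiniteDimensional ℝ (Y i)]
    (i : Fin s) (u v : PiLp 2 Y) (t h : Y i) (l : ℝ) :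
    splice i u (t + l • h) v = splice i u t v + l • blkIncl i h := by
  ext j
  rw [PiLp.add_apply, PiLp.smul_apply]
  rcases lt_trichotomy j i with hj | rfl | hj
  · rw [splice_lt hj, splice_lt hj, blkIncl_apply_ne hj.ne, smul_zero, add_zero]
  · rw [splice_same, splice_same, blkIncl_apply_same]
  · rw [splice_gt hj, splice_gt hj, blkIncl_apply_ne hj.ne', smul_zero, add_zero]

namespace Data

variable {X : Type*} {s : ℕ} [NeZero s] {Y : Fin s → Type*} {Z : Type*}
  [NormedAddCommGroup X] [InnerProductSpace ℝ X] [FiniteDimensional ℝ X]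
  [∀ i, NormedAddCommGroup (Y i)] [∀ i, InnerProductSpace ℝ (Y i)]
  [∀ i, FiniteDimensional ℝ (Y i)]
  [NormedAddCommGroup Z] [InnerProductSpace ℝ Z] [FiniteDimensional ℝ Z]
  {P : Data X Y Z}

/-- The smooth part of the majorized augmented Lagrangian. -/
noncomputable def smoothLag (P : Data X Y Z) (y : PiLp 2 Y) (z : Z) (x : X) (y' : PiLp 2 Y) : ℝ :=
  P.fhat y y' - ⟪P.b, z⟫_ℝ + ⟪P.infeas y z, x⟫_ℝ + P.σ / 2 * ‖P.infeas y z‖ ^ 2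

/-- The partial gradient in `y` of the smooth part of the majorized augmented Lagrangian. -/
noncomputable def gradLag (P : Data X Y Z) (y : PiLp 2 Y) (z : Z) (x : X) (y' : PiLp 2 Y) :
    PiLp 2 Y :=
  gradient P.f y' + P.Sig (y - y') + P.F (x + P.σ • P.infeas y z)

theorem infeas_add (y e : PiLp 2 Y) (z : Z) :
    P.infeas (y + e) z = P.infeas y z + ContinuousLinearMap.adjoint P.F e := by
  rw [infeas, infeas, map_add]; abel

/-- With f replaced by its model f̂, the smooth part is exactly quadratic in y; this is the
expansion that `sub_mem_subdiff_of_add` requires. -/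
theorem smoothLag_add_smul (hP : P.Standing) (y e : PiLp 2 Y) (z : Z) (x : X) (y' : PiLp 2 Y)
    (l : ℝ) : P.smoothLag (y + l • e) z x y' = P.smoothLag y z x y'
      + l * ⟪P.gradLag y z x y', e⟫_ℝ + l ^ 2 * (1 / 2 * ⟪e, P.Sig e⟫_ℝ
        + P.σ / 2 * ‖ContinuousLinearMap.adjoint P.F e‖ ^ 2) := by
  have h1 : y + l • e - y' = (y - y') + l • e := by abel
  have h2 : ⟪y - y', P.Sig e⟫_ℝ = ⟪P.Sig (y - y'), e⟫_ℝ := (hP.inner_Sig_comm _ _).symm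
  have h3 : ⟪e, P.Sig (y - y')⟫_ℝ = ⟪P.Sig (y - y'), e⟫_ℝ := real_inner_comm _ _
  have h4 : ⟪P.F (x + P.σ • P.infeas y z), e⟫_ℝ = ⟪ContinuousLinearMap.adjoint P.F e, x⟫_ℝ
      + P.σ * ⟪P.infeas y z, ContinuousLinearMap.adjoint P.F e⟫_ℝ := by
    rw [← ContinuousLinearMap.adjoint_inner_right, inner_add_left, real_inner_smul_left,
      real_inner_comm]
  simp only [smoothLag, fhat, gradLag, infeas_add, h1, map_smul, map_add, norm_add_sq_real,
    inner_add_left, inner_add_right, real_inner_smul_left, real_inner_smul_right, norm_smul,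
    mul_pow, Real.norm_eq_abs, sq_abs, h2, h3] at h4 ⊢
  rw [h4]
  ring

theorem smoothLag_splice_expansion (hP : P.Standing) (i : Fin s) (u v : PiLp 2 Y) (t : Y i) (z : Z)
    (x : X) (y' : PiLp 2 Y) (h : Y i) :
    ∃ q : ℝ, ∀ l : ℝ, P.smoothLag (splice i u (t + l • h) v) z x y'
      = P.smoothLag (splice i u t v) z x y'
        + l * ⟪P.gradLag (splice i u t v) z x y' i, h⟫_ℝ + l ^ 2 * q :=
  ⟨1 / 2 * ⟪blkIncl i h, P.Sig (blkIncl i h)⟫_ℝ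
    + P.σ / 2 * ‖ContinuousLinearMap.adjoint P.F (blkIncl i h)‖ ^ 2, fun l => by
      rw [splice_add_smul, smoothLag_add_smul hP, inner_blkIncl_right]⟩

theorem mem_subdiff_augLag_zero (hP : P.Standing) {u v : PiLp 2 Y} {z : Z} {x : X}
    {y' : PiLp 2 Y} {d t : Y 0}
    (h : d ∈ subdiff (fun t => P.augLag (splice 0 u t v) z x y') t) :
    P.p t ≠ ⊤ ∧ d - P.gradLag (splice 0 u t v) z x y' 0 ∈ subdiff P.p t := by
  have h' : d ∈ subdiff (fun t => P.p t + (P.smoothLag (splice 0 u t v) z x y' : EReal)) t := by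
    simp only [augLag, splice_same] at h
    exact h
  have ht : P.p t ≠ ⊤ := by
    obtain ⟨α, hα⟩ := exists_coe_of_mem_subdiff
      (fun t => EReal.add_ne_bot_iff.mpr ⟨hP.p_cpc.ne_bot t, EReal.coe_ne_bot _⟩)
      (hP.p_cpc.exists_ne_top.imp fun t ht => EReal.add_ne_top ht (EReal.coe_ne_top _)) h'
    intro htop
    rw [htop, EReal.top_add_coe] at hα
    exact EReal.top_ne_coe _ hα
  refine ⟨ht, sub_mem_subdiff_of_add hP.p_cpc.ne_bot hP.p_cpc.convex ht
    (fun k => smoothLag_splice_expansion hP 0 u v t z x y' k) h'⟩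

/-- Away from the first block the nonsmooth term is the constant p(u₁), whose only subgradient is 0.
Finiteness of that constant is essential: if it were +∞, every vector would be a subgradient. Hence
the starting point must lie in dom p. -/
theorem eq_gradLag_of_mem_subdiff_augLag (hP : P.Standing) {i : Fin s} (hi : i ≠ 0)
    {u v : PiLp 2 Y} (hu : P.p (u 0) ≠ ⊤) {z : Z} {x : X} {y' : PiLp 2 Y} {d t : Y i}
    (h : d ∈ subdiff (fun t => P.augLag (splice i u t v) z x y') t) :
    d = P.gradLag (splice i u t v) z x y' i := by
  have h' : d ∈ subdiff (fun t => P.p (u 0) + (P.smoothLag (splice i u t v) z x y' : EReal)) t := by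
    simp only [augLag, splice_lt (Fin.pos_iff_ne_zero.mpr hi)] at h
    exact h
  have h1 := sub_mem_subdiff_of_add (θ := fun _ => P.p (u 0))
    (a := P.gradLag (splice i u t v) z x y' i) (fun _ => hP.p_cpc.ne_bot _)
    ?_ hu (fun k => smoothLag_splice_expansion hP i u v t z x y' k) h'
  · set g := d - P.gradLag (splice i u t v) z x y' i with hg
    have h2 := h1 (t + g)
    obtain ⟨α, hα⟩ : ∃ α : ℝ, P.p (u 0) = α :=
      ⟨_, (EReal.coe_toReal hu (hP.p_cpc.ne_bot _)).symm⟩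
    simp only [hα, add_sub_cancel_left] at h2
    norm_cast at h2
    rw [real_inner_self_eq_norm_sq] at h2
    have h3 : ‖g‖ ^ 2 = 0 := le_antisymm (by linarith) (sq_nonneg _)
    exact sub_eq_zero.mp (norm_eq_zero.mp (sq_eq_zero_iff.mp h3))
  · intro q hq r hr a b ha hb hab
    have := hP.p_cpc.convex (x := (u 0, q.2)) (y := (u 0, r.2)) hq hr ha hb hab
    simpa [← add_smul, hab] using this

section Run

variable {ε : ℕ → ℝ} {x : ℕ → X} {y yh : ℕ → PiLp 2 Y} {z : ℕ → Z} {δt δ : ℕ → ∀ i, Y i}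

theorem IsRun.p_ne_top (hP : P.Standing) (hr : P.IsRun ε x y yh z δt δ) (k : ℕ) :
    P.p (y k 0) ≠ ⊤ := by
  cases k with
  | zero => exact hr.init
  | succ k => exact (mem_subdiff_augLag_zero hP (hr.step2 k 0).2).1

/-- The aggregated error `δ + 𝒩_u 𝒩_d⁻¹ (δ - δ̃)` of one block symmetric Gauss-Seidel sweep. -/
noncomputable def sweepError (P : Data X Y Z) (d dt : ∀ i, Y i) : PiLp 2 Y :=
  WithLp.toLp 2 d + P.Nu (ContinuousLinearMap.inverse P.Nd
    (WithLp.toLp 2 d - WithLp.toLp 2 (fun i => if i = 0 then d i else dt i)))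

theorem exists_sweepError_le (P : Data X Y Z) : ∃ c > 0, ∀ (d dt : ∀ i, Y i) (M : ℝ), 0 ≤ M →
    (∀ i, (i ≠ 0 → ‖dt i‖ ≤ M) ∧ ‖d i‖ ≤ M) → ‖P.sweepError d dt‖ ≤ c * M := by
  set B := P.Nu ∘L ContinuousLinearMap.inverse P.Nd
  refine ⟨√s + ‖B‖ * (√s + √s) + 1, by positivity, fun d dt M hM h => ?_⟩
  have h1 : ‖(WithLp.toLp 2 d : PiLp 2 Y)‖ ≤ √s * M :=
    norm_le_of_forall_blk_le hM fun i => (h i).2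
  have h2 : ‖(WithLp.toLp 2 (fun i => if i = 0 then d i else dt i) : PiLp 2 Y)‖ ≤ √s * M := by
    refine norm_le_of_forall_blk_le hM fun i => ?_
    change ‖if i = 0 then d i else dt i‖ ≤ M
    split_ifs with hi
    · exact (h i).2
    · exact (h i).1 hi
  calc ‖P.sweepError d dt‖ ≤ ‖(WithLp.toLp 2 d : PiLp 2 Y)‖ + ‖B (WithLp.toLp 2 d
        - WithLp.toLp 2 (fun i => if i = 0 then d i else dt i))‖ := norm_add_le _ _
    _ ≤ √s * M + ‖B‖ * (√s * M + √s * M) := by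
        gcongr
        exact (B.le_opNorm _).trans (by gcongr; exact (norm_sub_le _ _).trans (add_le_add h1 h2))
    _ ≤ _ := by linarith

/-- One sweep of the block symmetric Gauss-Seidel method is one inexact proximal step with the
additional proximal term `𝒩_sGS`. -/
theorem IsRun.sweep (hP : P.Standing) (hD : P.ProxCond) (hr : P.IsRun ε x y yh z δt δ) (k : ℕ) :
    (P.sweepError (δ k) (δt k) - (gradient P.f (y k) + P.F (x k + P.σ • P.infeas (y k) (z k)))
      - (P.Nop (y (k + 1) - y k) + P.Nsgs (y (k + 1) - y k))) 0 ∈ subdiff P.p (y (k + 1) 0) ∧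
    ∀ i, i ≠ 0 → (P.sweepError (δ k) (δt k)
      - (gradient P.f (y k) + P.F (x k + P.σ • P.infeas (y k) (z k)))
      - (P.Nop (y (k + 1) - y k) + P.Nsgs (y (k + 1) - y k))) i = 0 := by
  set G₀ := gradient P.f (y k) + P.F (x k + P.σ • P.infeas (y k) (z k)) with hG₀
  set Δ := y (k + 1) - y k with hΔ
  set h := yh k - y k with hh
  set dv : PiLp 2 Y := WithLp.toLp 2 (δ k) with hdv
  set dtv : PiLp 2 Y := WithLp.toLp 2 (fun i => if i = 0 then δ k i else δt k i) with hdtv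
  have hN := isSelfAdjoint_Nop hP hD
  have hgrad : ∀ (i : Fin s) (v : PiLp 2 Y), P.gradLag v (z k) (x k) (y k) i
      + P.D i (v i - y k i) = G₀ i + P.Nop (v - y k) i := by
    intro i v
    have e : v = y k + (v - y k) := by abel
    have e1 : P.gradLag v (z k) (x k) (y k) + P.Dop (v - y k) = G₀ + P.Nop (v - y k) := by
      rw [gradLag, Nop_apply, hG₀]
      conv_lhs => rw [show P.infeas v (z k) = P.infeas (y k) (z k)
        + ContinuousLinearMap.adjoint P.F (v - y k) by rw [← infeas_add, ← e]]
      simp only [map_add, map_smul, smul_add]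
      abel
    have e2 := congrArg (fun w : PiLp 2 Y => w i) e1
    simp only [PiLp.add_apply] at e2
    rw [← e2, Dop, blockDiag_apply]
    rfl
  -- Blocks before i are still at yᵏ, so the lower triangular part acts on 0. In the forward sweep
  -- those blocks carry Δ instead, which adds 𝒩_u*Δ.
  have hback : ∀ i, i ≠ 0 → dtv i = G₀ i + (P.Nd h i + P.Nu h i) := by
    intro i hi
    have h1 := eq_gradLag_of_mem_subdiff_augLag hP hi (hr.p_ne_top hP k) (hr.step1 k i hi).2
    have h2 := hgrad i (splice i (y k) (yh k i) (yh k))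
    rw [← h1, splice_same, sub_add_cancel, apply_eq_diag_add_triangular hN (a := 0) (b := h)
      (c := h)] at h2
    · rw [map_zero, PiLp.zero_apply, add_zero] at h2
      simp only [hdtv, hi, if_false]
      exact h2
    · intro j hj; rw [PiLp.sub_apply, splice_lt hj, sub_self, PiLp.zero_apply]
    · intro j hj; rw [PiLp.sub_apply, splice_gt hj, hh, PiLp.sub_apply]
    · rw [PiLp.sub_apply, splice_same, hh, PiLp.sub_apply]
  have hforw : ∀ i, P.gradLag (splice i (y (k + 1)) (y (k + 1) i) (yh k)) (z k) (x k) (y k) i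
      + P.D i (y (k + 1) i - y k i)
      = G₀ i + (P.Nd Δ i + ContinuousLinearMap.adjoint P.Nu Δ i + P.Nu h i) := by
    intro i
    have h2 := hgrad i (splice i (y (k + 1)) (y (k + 1) i) (yh k))
    rw [splice_same, apply_eq_diag_add_triangular hN (a := Δ) (b := h) (c := Δ)] at h2
    · exact h2
    · intro j hj; rw [PiLp.sub_apply, splice_lt hj, hΔ, PiLp.sub_apply]
    · intro j hj; rw [PiLp.sub_apply, splice_gt hj, hh, PiLp.sub_apply]
    · rw [PiLp.sub_apply, splice_same, hΔ, PiLp.sub_apply]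
  have hrow : ∀ i, i ≠ 0 → P.Nd (Δ - h) i
      = (dv - dtv - ContinuousLinearMap.adjoint P.Nu Δ) i := by
    intro i hi
    have h1 := eq_gradLag_of_mem_subdiff_augLag hP hi (hr.p_ne_top hP (k + 1)) (hr.step2 k i).2
    have h2 := hforw i
    rw [← h1, sub_add_cancel] at h2
    have h3 := hback i hi
    have h4 : dv i = δ k i := rfl
    rw [map_sub, PiLp.sub_apply, PiLp.sub_apply, PiLp.sub_apply, h3, h4, h2]
    abel
  -- Row 0 of the difference of the sweeps is unavailable, since the first block of the half-step is
  -- arbitrary. It is not needed: a strictly upper triangular operator never reads the first block.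
  have hNu : P.Nu (Δ - h) = P.Nu (ContinuousLinearMap.inverse P.Nd
      (dv - dtv - ContinuousLinearMap.adjoint P.Nu Δ)) := by
    set q := ContinuousLinearMap.inverse P.Nd (dv - dtv - ContinuousLinearMap.adjoint P.Nu Δ)
      with hq
    have h1 : ∀ j, j ≠ 0 → (Δ - h) j = q j := by
      intro j hj
      have h2 := hrow j hj
      rw [← Nd_inverse_apply hP hD (dv - dtv - ContinuousLinearMap.adjoint P.Nu Δ), ← hq, Nd,
        blockDiag_apply, blockDiag_apply] at h2
      exact (posDef_block_Nop hP hD j).injective h2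
    ext i
    rw [Nu, blockUpper_apply, blockUpper_apply]
    refine Finset.sum_congr rfl fun j hj => ?_
    rw [h1 j (Fin.pos_iff_ne_zero.mp ((Fin.zero_le i).trans_lt (Finset.mem_Ioi.mp hj)))]
  have hfin : P.sweepError (δ k) (δt k) - G₀ - (P.Nop Δ + P.Nsgs Δ)
      = dv - G₀ - (P.Nd Δ + ContinuousLinearMap.adjoint P.Nu Δ + P.Nu h) := by
    have e1 : P.Nop Δ = P.Nd Δ + ContinuousLinearMap.adjoint P.Nu Δ + P.Nu Δ :=
      eq_diag_add_triangular hN Δ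
    have e2 : P.Nsgs Δ = P.Nu (ContinuousLinearMap.inverse P.Nd
      (ContinuousLinearMap.adjoint P.Nu Δ)) := rfl
    have e3 : P.sweepError (δ k) (δt k)
      = dv + P.Nu (ContinuousLinearMap.inverse P.Nd (dv - dtv)) := rfl
    have e4 : P.Nu Δ = P.Nu h + (P.Nu (ContinuousLinearMap.inverse P.Nd (dv - dtv))
        - P.Nu (ContinuousLinearMap.inverse P.Nd (ContinuousLinearMap.adjoint P.Nu Δ))) := by
      rw [← map_sub P.Nu, ← map_sub, ← hNu, ← map_add]
      congr 1; abel
    rw [e3, e1, e2, e4]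
    abel
  have hcomp : ∀ i, (dv - G₀ - (P.Nd Δ + ContinuousLinearMap.adjoint P.Nu Δ + P.Nu h)) i
      = δ k i - P.D i (y (k + 1) i - y k i)
        - P.gradLag (splice i (y (k + 1)) (y (k + 1) i) (yh k)) (z k) (x k) (y k) i := by
    intro i
    rw [sub_sub (δ k i), add_comm (P.D i _), hforw i]
    simp only [PiLp.sub_apply, PiLp.add_apply]
    rw [sub_sub]
  rw [hfin]
  refine ⟨?_, fun i hi => ?_⟩
  · rw [hcomp 0]
    exact (mem_subdiff_augLag_zero hP (hr.step2 k 0).2).2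
  · rw [hcomp i, sub_eq_zero]
    exact eq_gradLag_of_mem_subdiff_augLag hP hi (hr.p_ne_top hP (k + 1)) (hr.step2 k i).2

/-- If G xᵏ = b, then γᵏ = 0 says G rᵏ⁺¹ = 0, and the multiplier update preserves G x = b. Nothing
is claimed about r⁰. -/
theorem IsRun.G_eq (hP : P.Standing) (hr : P.IsRun ε x y yh z δt δ) (h0 : P.b - P.G (x 0) = 0)
    (hγ : ∀ k, P.gam (x k) (y (k + 1)) (z (k + 1)) = 0) (k : ℕ) :
    P.G (x k) = P.b ∧ P.G (P.infeas (y (k + 1)) (z (k + 1))) = 0 := by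
  have hstep : ∀ k, P.G (x k) = P.b → P.G (P.infeas (y (k + 1)) (z (k + 1))) = 0 := by
    intro k hk
    have := hγ k
    rw [gam, hk, sub_self, zero_add, smul_eq_zero] at this
    exact this.resolve_left hP.σ_pos.ne'
  induction k with
  | zero => exact ⟨(sub_eq_zero.mp h0).symm, hstep 0 (sub_eq_zero.mp h0).symm⟩
  | succ k ih =>
    have : P.G (x (k + 1)) = P.b := by
      rw [hr.step4 k, map_add, map_smul, ih.1, ih.2, smul_zero, add_zero]
    exact ⟨this, hstep _ this⟩

/-- `d - ∇f(y) - (𝒫 + 𝒯)_Y (y⁺ - y) - F (x + σ r⁺)` is a subgradient of `(p, 0)` at `y⁺`. -/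
def IsStep (P : Data X Y Z) (x : X) (y y' : PiLp 2 Y) (z' : Z) (d : PiLp 2 Y) : Prop :=
  (d - gradient P.f y - P.Sop (y' - y) - P.F (x + P.σ • P.infeas y' z')) 0
      ∈ subdiff P.p (y' 0) ∧
    ∀ i, i ≠ 0 → (d - gradient P.f y - P.Sop (y' - y) - P.F (x + P.σ • P.infeas y' z')) i = 0

/-- The sweep uses the old z. With w the increment of z, vanishing of G r at both ends gives G F*Δ =
-G G*w. Hence the pseudoinverse term of 𝒯 applied to Δ is -σ F G*w, exactly the correction that
replaces r(yᵏ⁺¹, zᵏ) by r(yᵏ⁺¹, zᵏ⁺¹). -/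
theorem IsRun.isStep (hP : P.Standing) (hD : P.ProxCond) (hr : P.IsRun ε x y yh z δt δ)
    {k : ℕ} (h1 : P.G (P.infeas (y k) (z k)) = 0)
    (h2 : P.G (P.infeas (y (k + 1)) (z (k + 1))) = 0) :
    P.IsStep (x k) (y k) (y (k + 1)) (z (k + 1)) (P.sweepError (δ k) (δt k)) := by
  have h := hr.sweep hP hD k
  have key : gradient P.f (y k) + P.F (x k + P.σ • P.infeas (y k) (z k))
      + (P.Nop (y (k + 1) - y k) + P.Nsgs (y (k + 1) - y k))
      = gradient P.f (y k) + P.Sop (y (k + 1) - y k)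
        + P.F (x k + P.σ • P.infeas (y (k + 1)) (z (k + 1))) := by
    set Δ := y (k + 1) - y k with hΔ
    set w := z (k + 1) - z k with hw
    have e1 : P.infeas (y (k + 1)) (z (k + 1)) = P.infeas (y k) (z k)
        + (ContinuousLinearMap.adjoint P.F Δ + ContinuousLinearMap.adjoint P.G w) := by
      simp only [infeas, hΔ, hw, map_sub]; abel
    have e2 : P.G (ContinuousLinearMap.adjoint P.F Δ)
        = P.G (ContinuousLinearMap.adjoint P.G (-w)) := by
      rw [e1, map_add, h1, zero_add, map_add] at h2
      rw [map_neg, map_neg, ← add_eq_zero_iff_eq_neg]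
      exact h2
    have e3 : P.Sg Δ = -(P.σ • P.F (ContinuousLinearMap.adjoint P.G w)) := by
      rw [Sg_apply, e2, adjoint_pinv_gram_apply, map_neg, map_neg, smul_neg]
    have e4 : P.Sop Δ = P.Sig Δ + (P.Dop Δ + P.Nsgs Δ + P.Sg Δ) := rfl
    rw [e4, e3, e1, Nop_apply]
    simp only [map_add, map_smul, smul_add]
    abel
  have key' : P.sweepError (δ k) (δt k) - gradient P.f (y k) - P.Sop (y (k + 1) - y k)
        - P.F (x k + P.σ • P.infeas (y (k + 1)) (z (k + 1)))
      = P.sweepError (δ k) (δt k) - (gradient P.f (y k) + P.F (x k + P.σ • P.infeas (y k) (z k)))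
      - (P.Nop (y (k + 1) - y k) + P.Nsgs (y (k + 1) - y k)) := by
    rw [sub_sub, sub_sub, sub_sub, key, ← add_assoc]
  rw [IsStep, key']
  exact h

end Run

end Data
end SGSADMM

/-! ### Descent and residual estimates for one step -/

namespace SGSADMM
namespace Data

variable {X : Type*} {s : ℕ} [NeZero s] {Y : Fin s → Type*} {Z : Type*}
  [NormedAddCommGroup X] [InnerProductSpace ℝ X] [FiniteDimensional ℝ X]
  [∀ i, NormedAddCommGroup (Y i)] [∀ i, InnerProductSpace ℝ (Y i)]
  [∀ i, FiniteDimensional ℝ (Y i)]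
  [NormedAddCommGroup Z] [InnerProductSpace ℝ Z] [FiniteDimensional ℝ Z]
  {P : Data X Y Z}

theorem Standing.gradient_le (hP : P.Standing) (a b : PiLp 2 Y) :
    P.f b + ⟪gradient P.f b, a - b⟫_ℝ ≤ P.f a :=
  gradient_inequality hP.f_convex (hP.f_smooth.differentiable one_ne_zero) a b

theorem inner_nonneg_of_blk_zero {g v : PiLp 2 Y} (h0 : 0 ≤ ⟪g 0, v 0⟫_ℝ)
    (h : ∀ i, i ≠ 0 → g i = 0) : 0 ≤ ⟪g, v⟫_ℝ := by
  rw [PiLp.inner_apply, Finset.sum_eq_single 0]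
  · exact h0
  · intro i _ hi; rw [h i hi, inner_zero_left]
  · simp

/-- The decrease of the squared `Ω`-distance in one step. -/
noncomputable def decrease (P : Data X Y Z) (w w' : WithLp 2 (PiLp 2 Y × Z)) : ℝ :=
  ⟪w' - w, P.Xi (w' - w)⟫_ℝ + P.τ * P.σ * ((2 - P.τ) * P.σ / 3) *
    ‖P.infeas w'.fst w'.snd‖ ^ 2

theorem infeas_eq (w : WithLp 2 (PiLp 2 Y × Z)) :
    P.infeas w.fst w.snd = ContinuousLinearMap.adjoint P.Aop w - P.c := by
  rw [adjoint_Aop_apply, infeas]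

theorem decrease_nonneg (hP : P.Standing) (hD : P.ProxCond) (w w' : WithLp 2 (PiLp 2 Y × Z)) :
    0 ≤ P.decrease w w' := by
  have h1 := inner_Xi_nonneg hP hD (w' - w)
  have h2 := hP.penalty_pos
  have h3 := hP.τσ_pos
  exact add_nonneg h1 (by positivity)

/-- The subgradients of p at the new point and at the KKT point are paired by monotonicity. The ∇f
term is handled by `three_point_gradient`, the proximal term by polarisation of 𝒫 + 𝒯, and the
F-term becomes ⟪x - x̄, r'⟫ + σ‖r'‖², which the multiplier update converts into squared distances.
-/
theorem IsStep.descent (hP : P.Standing) (hD : P.ProxCond) {x x' : X} {y y' : PiLp 2 Y}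
    {z z' : Z} {d : PiLp 2 Y} (hs : P.IsStep x y y' z' d) (hG : P.G x = P.b)
    (hr' : P.G (P.infeas y' z') = 0) (hx' : x' = x + (P.τ * P.σ) • P.infeas y' z')
    {ub : WithLp 2 (X × WithLp 2 (PiLp 2 Y × Z))} (hub : ub ∈ P.kktSet) :
    opNorm P.Omega (point x' y' z' - ub) ^ 2
        + P.decrease (WithLp.toLp 2 (y, z)) (WithLp.toLp 2 (y', z'))
      ≤ opNorm P.Omega (point x y z - ub) ^ 2 + 2 * (P.τ * P.σ) * ⟪d, y' - ub.snd.fst⟫_ℝ := by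
  obtain ⟨hk1, hk2, hk3, hk4⟩ := hub
  set xb := ub.fst with hxb
  set yb := ub.snd.fst with hyb
  set zb := ub.snd.snd with hzb
  set r := P.infeas y z with hr
  set r' := P.infeas y' z' with hrr
  have hAb : ContinuousLinearMap.adjoint P.Aop ub.snd = P.c := by rw [adjoint_Aop_apply]; exact hk4
  have hA : ContinuousLinearMap.adjoint P.Aop (WithLp.toLp 2 (y, z) - ub.snd) = r := by
    rw [map_sub, hAb, ← infeas_eq]; rfl
  have hA' : ContinuousLinearMap.adjoint P.Aop (WithLp.toLp 2 (y', z') - ub.snd) = r' := by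
    rw [map_sub, hAb, ← infeas_eq]; rfl
  have hAA : ContinuousLinearMap.adjoint P.Aop
      (WithLp.toLp 2 (y', z') - WithLp.toLp 2 (y, z)) = r' - r := by
    rw [← hA, ← hA', ← map_sub]; congr 1; abel
  have hn' : opNorm P.Omega (point x' y' z' - ub) ^ 2 = ‖x' - xb‖ ^ 2 + P.τ * P.σ *
      (⟪y' - yb, P.Sop (y' - yb)⟫_ℝ + (2 - P.τ) * P.σ / 3 * ‖r'‖ ^ 2) := by
    rw [opNorm_Omega_sq hP hD, inner_Theta, ← hA']; rfl
  have hn : opNorm P.Omega (point x y z - ub) ^ 2 = ‖x - xb‖ ^ 2 + P.τ * P.σ *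
      (⟪y - yb, P.Sop (y - yb)⟫_ℝ + (2 - P.τ) * P.σ / 3 * ‖r‖ ^ 2) := by
    rw [opNorm_Omega_sq hP hD, inner_Theta, ← hA]; rfl
  have hdec : P.decrease (WithLp.toLp 2 (y, z)) (WithLp.toLp 2 (y', z'))
      = P.τ * P.σ * (1 / 2 * ⟪y' - y, P.Sig (y' - y)⟫_ℝ + ⟪y' - y, P.Ty (y' - y)⟫_ℝ
        + (2 - P.τ) * P.σ / 6 * ‖r' - r‖ ^ 2)
        + P.τ * P.σ * ((2 - P.τ) * P.σ / 3) * ‖r'‖ ^ 2 := by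
    rw [decrease, inner_Xi, hAA]; rfl
  have hmono : 0 ≤ ⟪d - gradient P.f y - P.Sop (y' - y) - P.F (x + P.σ • r')
      + (gradient P.f yb + P.F xb), y' - yb⟫_ℝ := by
    refine inner_nonneg_of_blk_zero ?_ ?_
    · have := subdiff_monotone hP.p_cpc.ne_bot hP.p_cpc.exists_ne_top hs.1 hk1
      rw [sub_neg_eq_add] at this
      exact this
    · intro i hi
      rw [PiLp.add_apply, hs.2 i hi, hk2 i hi, add_zero]
  have h3 := three_point_gradient hP.gradient_le (fun a b => hP.majorize a b) y yb y'
  have h4 : 2 * ⟪P.Sop (y' - y), y' - yb⟫_ℝ = ⟪y' - y, P.Sop (y' - y)⟫_ℝ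
      + ⟪y' - yb, P.Sop (y' - yb)⟫_ℝ - ⟪y - yb, P.Sop (y - yb)⟫_ℝ := by
    have e : y' - yb = (y' - y) + (y - yb) := by abel
    rw [e, map_add]
    simp only [inner_add_left, inner_add_right]
    have e1 := inner_Sop_comm hP hD (y' - y) (y - yb)
    have e2 := inner_Sop_comm hP hD (y' - y) (y' - y)
    have e3 : ⟪y - yb, P.Sop (y' - y)⟫_ℝ = ⟪P.Sop (y' - y), y - yb⟫_ℝ := real_inner_comm _ _
    linarith
  have h5 : ⟪P.F (x + P.σ • r') - P.F xb, y' - yb⟫_ℝ = ⟪x - xb, r'⟫_ℝ + P.σ * ‖r'‖ ^ 2 := by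
    rw [← map_sub, ← ContinuousLinearMap.adjoint_inner_right]
    have e : ContinuousLinearMap.adjoint P.F (y' - yb)
        = r' - ContinuousLinearMap.adjoint P.G (z' - zb) := by
      rw [hrr, infeas, ← hk4, map_sub, map_sub]; abel
    have e2 : P.G (x + P.σ • r' - xb) = 0 := by
      rw [map_sub, map_add, map_smul, hr', hG, smul_zero, add_zero, ← neg_sub, hk3, neg_zero]
    rw [e, inner_sub_right, ContinuousLinearMap.adjoint_inner_right, e2, inner_zero_left, sub_zero,
      show x + P.σ • r' - xb = (x - xb) + P.σ • r' by abel, inner_add_left, real_inner_smul_left,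
      real_inner_self_eq_norm_sq]
  have h6 : ‖x' - xb‖ ^ 2 = ‖x - xb‖ ^ 2 + 2 * (P.τ * P.σ) * ⟪x - xb, r'⟫_ℝ
      + (P.τ * P.σ) ^ 2 * ‖r'‖ ^ 2 := by
    rw [hx', show x + (P.τ * P.σ) • r' - xb = (x - xb) + (P.τ * P.σ) • r' by abel,
      norm_add_sq_real, real_inner_smul_right, norm_smul, mul_pow, Real.norm_eq_abs, sq_abs]
    ring
  -- The available term τσ(2-τ)σ‖r'‖² is spent in thirds: one for the Θ-norm at the new point, one
  -- for `decrease`, and one, through this bound, for the 𝒜𝒜* part of Ξ. The last also uses the ‖r‖²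
  -- of the old Θ-norm.
  have h7 : ‖r' - r‖ ^ 2 ≤ 2 * ‖r'‖ ^ 2 + 2 * ‖r‖ ^ 2 := by
    have := parallelogram_law_with_norm ℝ r' r
    nlinarith [norm_nonneg (r' + r), sq_nonneg ‖r' + r‖]
  have hm2 : 0 ≤ ⟪d, y' - yb⟫_ℝ - ⟪gradient P.f y - gradient P.f yb, y' - yb⟫_ℝ
      - ⟪P.Sop (y' - y), y' - yb⟫_ℝ - ⟪P.F (x + P.σ • r') - P.F xb, y' - yb⟫_ℝ := by
    simp only [inner_add_left, inner_sub_left] at hmono ⊢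
    linarith
  rw [h5] at hm2
  have hS := inner_Sop (P := P) (y' - y)
  have hmain : 0 ≤ 2 * (P.τ * P.σ) * (⟪d, y' - yb⟫_ℝ + 1 / 4 * ⟪y' - y, P.Sig (y' - y)⟫_ℝ
      - 1 / 2 * (⟪y' - y, P.Sig (y' - y)⟫_ℝ + ⟪y' - y, P.Ty (y' - y)⟫_ℝ
      + ⟪y' - yb, P.Sop (y' - yb)⟫_ℝ - ⟪y - yb, P.Sop (y - yb)⟫_ℝ)
      - (⟪x - xb, r'⟫_ℝ + P.σ * ‖r'‖ ^ 2)) := by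
    refine mul_nonneg (by linarith [hP.τσ_pos]) ?_
    linarith
  have h8 : 0 ≤ P.τ * P.σ * ((2 - P.τ) * P.σ) / 6 * (2 * ‖r'‖ ^ 2 + 2 * ‖r‖ ^ 2 - ‖r' - r‖ ^ 2) := by
    have := hP.τσ_pos
    have := hP.penalty_pos
    refine mul_nonneg (by positivity) (by linarith)
  rw [hn, hn', hdec, h6]
  linarith

theorem hasGradientAt_objective (hP : P.Standing) (w : WithLp 2 (PiLp 2 Y × Z)) :
    HasGradientAt (fun w : WithLp 2 (PiLp 2 Y × Z) => P.f w.fst - ⟪P.b, w.snd⟫_ℝ)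
      (WithLp.toLp 2 (gradient P.f w.fst, -P.b)) w := by
  have h1 : HasFDerivAt P.f (InnerProductSpace.toDual ℝ _ (gradient P.f w.fst)) w.fst :=
    (hP.f_smooth.differentiable one_ne_zero w.fst).hasGradientAt.hasFDerivAt
  have h2 : HasFDerivAt (fun w : WithLp 2 (PiLp 2 Y × Z) => P.f w.fst)
      ((InnerProductSpace.toDual ℝ _ (gradient P.f w.fst)).comp
        (WithLp.fstL 2 ℝ (PiLp 2 Y) Z)) w :=
    h1.comp w (WithLp.fstL 2 ℝ (PiLp 2 Y) Z).hasFDerivAt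
  have h3 : HasFDerivAt (fun w : WithLp 2 (PiLp 2 Y × Z) => ⟪P.b, w.snd⟫_ℝ)
      ((innerSL ℝ P.b).comp (WithLp.sndL 2 ℝ (PiLp 2 Y) Z)) w :=
    ((innerSL ℝ P.b).comp (WithLp.sndL 2 ℝ (PiLp 2 Y) Z)).hasFDerivAt
  rw [hasGradientAt_iff_hasFDerivAt]
  have key : InnerProductSpace.toDual ℝ (WithLp 2 (PiLp 2 Y × Z))
      (WithLp.toLp 2 (gradient P.f w.fst, -P.b))
      = (InnerProductSpace.toDual ℝ _ (gradient P.f w.fst)).comp (WithLp.fstL 2 ℝ (PiLp 2 Y) Z)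
        - (innerSL ℝ P.b).comp (WithLp.sndL 2 ℝ (PiLp 2 Y) Z) := by
    ext v
    rw [InnerProductSpace.toDual_apply_apply, inner_prod]
    change ⟪gradient P.f w.fst, v.fst⟫_ℝ + ⟪-P.b, v.snd⟫_ℝ
      = ⟪gradient P.f w.fst, v.fst⟫_ℝ - ⟪P.b, v.snd⟫_ℝ
    rw [inner_neg_left, sub_eq_add_neg]
  rw [key]
  exact h2.sub h3

/-- Since (g; 0) ∈ ∂φ(w), w is the proximal image of w + (g; 0), so nonexpansiveness bounds the
second residual component by ‖(g; 0) + ∇h(w) + 𝒜x‖. Its Z-part G x - b vanishes. -/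
theorem norm_residual_sq_le (hP : P.Standing) {x : X} {y : PiLp 2 Y} {z : Z} {g : PiLp 2 Y}
    (h0 : g 0 ∈ subdiff P.p (y 0)) (hne : ∀ i, i ≠ 0 → g i = 0) (hG : P.G x = P.b) :
    ‖P.residual (point x y z)‖ ^ 2
      ≤ ‖P.infeas y z‖ ^ 2 + ‖g + (gradient P.f y + P.F x)‖ ^ 2 := by
  set w : WithLp 2 (PiLp 2 Y × Z) := WithLp.toLp 2 (y, z) with hw
  set φ : WithLp 2 (PiLp 2 Y × Z) → EReal := fun w => P.p (w.fst 0)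
  have hφ : ClosedProperConvex φ := by
    refine hP.p_cpc.comp_continuousLinearMap (blkProj 0 ∘L WithLp.fstL 2 ℝ (PiLp 2 Y) Z)
      fun t => ⟨WithLp.toLp 2 (blkIncl 0 t, 0), blkIncl_apply_same 0 t⟩
  set gg : WithLp 2 (PiLp 2 Y × Z) := WithLp.toLp 2 (g, 0) with hgg
  have hg : gg ∈ subdiff φ w := by
    intro w'
    have h1 := h0 (w'.fst 0)
    have h2 : ⟪gg, w' - w⟫_ℝ = ⟪g 0, w'.fst 0 - y 0⟫_ℝ := by
      rw [inner_prod]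
      change ⟪g, w'.fst - y⟫_ℝ + ⟪(0 : Z), _⟫_ℝ = _
      rw [inner_zero_left, add_zero, PiLp.inner_apply, Finset.sum_eq_single 0]
      · rfl
      · intro i _ hi; rw [hne i hi, inner_zero_left]
      · simp
    rw [h2]
    exact h1
  have hgrad : gradient (fun w : WithLp 2 (PiLp 2 Y × Z) => P.f w.fst - ⟪P.b, w.snd⟫_ℝ) w
      = WithLp.toLp 2 (gradient P.f y, -P.b) := (hasGradientAt_objective hP w).gradient
  have h1 := norm_sub_prox_le hφ hg
    (w - gradient (fun w : WithLp 2 (PiLp 2 Y × Z) => P.f w.fst - ⟪P.b, w.snd⟫_ℝ) w - P.Aop x)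
  have h2 : ‖w + gg - (w - gradient (fun w : WithLp 2 (PiLp 2 Y × Z) =>
      P.f w.fst - ⟪P.b, w.snd⟫_ℝ) w - P.Aop x)‖ ^ 2 = ‖g + (gradient P.f y + P.F x)‖ ^ 2 := by
    rw [hgrad, show w + gg - (w - WithLp.toLp 2 (gradient P.f y, -P.b) - P.Aop x)
      = gg + (WithLp.toLp 2 (gradient P.f y, -P.b) + P.Aop x) by abel,
      WithLp.prod_norm_sq_eq_of_L2]
    have e1 : (gg + (WithLp.toLp 2 (gradient P.f y, -P.b) + P.Aop x)).fst
      = g + (gradient P.f y + P.F x) := rfl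
    have e2 : (gg + (WithLp.toLp 2 (gradient P.f y, -P.b) + P.Aop x)).snd
      = 0 + (-P.b + P.G x) := rfl
    rw [e1, e2, hG]
    simp
  rw [WithLp.prod_norm_sq_eq_of_L2]
  have h3 : (P.residual (point x y z)).fst = -P.infeas y z := by
    change P.c - ContinuousLinearMap.adjoint P.Aop w = _
    rw [adjoint_Aop_apply, infeas, neg_sub]; rfl
  rw [h3, norm_neg, ← h2]
  gcongr
  exact h1

/-- The first factor of `ρ`. -/
noncomputable def rho₀ (P : Data X Y Z) : ℝ :=
  max ((6 * P.σ ^ 2 * (P.τ - 1) ^ 2 * ‖ContinuousLinearMap.adjoint P.Aop ∘L P.Aop‖ + 3)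
      / (P.τ * P.σ ^ 2 * (2 - P.τ)))
    (2 * P.zeta * ‖P.Pop + P.Tcal‖ / (P.τ * P.σ))

theorem rho_eq : P.rho = P.rho₀ * max ‖P.Theta‖ 1 := rfl

theorem rho₀_pos (hP : P.Standing) : 0 < P.rho₀ := by
  refine lt_max_of_lt_left (div_pos ?_ ?_)
  · positivity
  · have := hP.τ_pos
    have := hP.σ_pos
    have : 0 < 2 - P.τ := by linarith [hP.τ_lt]
    positivity

theorem norm_F_sq_le (v : X) :
    ‖P.F v‖ ^ 2 ≤ ‖ContinuousLinearMap.adjoint P.Aop ∘L P.Aop‖ * ‖v‖ ^ 2 := by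
  have h1 : ‖P.F v‖ ^ 2 ≤ ‖P.Aop v‖ ^ 2 := by
    rw [WithLp.prod_norm_sq_eq_of_L2 (P.Aop v), Aop_fst]
    linarith [sq_nonneg ‖(P.Aop v).snd‖]
  refine h1.trans ?_
  calc ‖P.Aop v‖ ^ 2 = ⟪(ContinuousLinearMap.adjoint P.Aop ∘L P.Aop) v, v⟫_ℝ := by
        rw [ContinuousLinearMap.comp_apply, ContinuousLinearMap.adjoint_inner_left,
          real_inner_self_eq_norm_sq]
    _ ≤ ‖(ContinuousLinearMap.adjoint P.Aop ∘L P.Aop) v‖ * ‖v‖ := real_inner_le_norm _ _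
    _ ≤ (‖ContinuousLinearMap.adjoint P.Aop ∘L P.Aop‖ * ‖v‖) * ‖v‖ := by
        gcongr; exact ContinuousLinearMap.le_opNorm _ _
    _ = _ := by ring

/-- The vector splits as the deviation of the gradient difference from ½Σ̂Δ, covered by
`gradient_deviation`, minus (½Σ̂ + 𝒯)Δ, covered by positive semidefiniteness of ½Σ̂ + 𝒯. Together
these give half the 𝒫 + 𝒯 forms of v and Δ, as `norm_sq_le_of_inner_le` requires. -/
theorem norm_gradient_deviation_sq_le (hP : P.Standing) (hD : P.ProxCond) (y y' : PiLp 2 Y) :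
    ‖gradient P.f y' - gradient P.f y - P.Sop (y' - y)‖ ^ 2
      ≤ ‖P.Pop + P.Tcal‖ * ⟪y' - y, P.Sop (y' - y)⟫_ℝ := by
  set e := gradient P.f y' - gradient P.f y - P.Sop (y' - y) with he
  set Δ := y' - y with hΔ
  have hY : ∀ v, ⟪v, e⟫_ℝ ≤ 1 / 2 * (⟪v, P.Sop v⟫_ℝ + ⟪Δ, P.Sop Δ⟫_ℝ) := by
    intro v
    have h1 := gradient_deviation hP.inner_Sig_comm hP.gradient_le
      (fun a b => hP.majorize a b) y' y v
    have h2 := half_Sig_add_Ty_nonneg hP hD (v + Δ)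
    have h3 := inner_Ty_comm hP hD v Δ
    have h4 := hP.inner_Sig_comm v Δ
    have e1 : ⟪P.Ty v, Δ⟫_ℝ = ⟪Δ, P.Ty v⟫_ℝ := real_inner_comm _ _
    have e2 : ⟪P.Sig v, Δ⟫_ℝ = ⟪Δ, P.Sig v⟫_ℝ := real_inner_comm _ _
    simp only [he, Sop_apply, map_add, inner_add_left, inner_add_right, inner_sub_right,
      real_inner_smul_right] at h1 h2 ⊢
    linarith
  have h := norm_sq_le_of_inner_le (S := P.Pop + P.Tcal)
    (e := (WithLp.toLp 2 (e, 0) : WithLp 2 (PiLp 2 Y × Z))) (q := ⟪Δ, P.Sop Δ⟫_ℝ) (fun v => by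
      rw [inner_Pop_add_Tcal, inner_prod]
      change ⟪v.fst, e⟫_ℝ + ⟪v.snd, (0 : Z)⟫_ℝ ≤ _
      rw [inner_zero_right, add_zero]
      exact hY v.fst)
  rw [WithLp.prod_norm_sq_eq_of_L2] at h
  change ‖e‖ ^ 2 + ‖(0 : Z)‖ ^ 2 ≤ _ at h
  simpa using h

theorem norm_deviation_sq_le_decrease (hP : P.Standing) (hD : P.ProxCond) (y y' : PiLp 2 Y)
    (z z' : Z) :
    2 * ‖gradient P.f y' - gradient P.f y - P.Sop (y' - y)‖ ^ 2
      ≤ P.rho₀ * ⟪(WithLp.toLp 2 (y', z') - WithLp.toLp 2 (y, z) : WithLp 2 (PiLp 2 Y × Z)),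
        P.Xi (WithLp.toLp 2 (y', z') - WithLp.toLp 2 (y, z))⟫_ℝ := by
  have h3 := norm_gradient_deviation_sq_le hP hD y y'
  set w : WithLp 2 (PiLp 2 Y × Z) := WithLp.toLp 2 (y', z') - WithLp.toLp 2 (y, z) with hw
  have hτσ := hP.τσ_pos
  have h5 : P.τ * P.σ * ⟪y' - y, P.Sop (y' - y)⟫_ℝ ≤ P.zeta * ⟪w, P.Xi w⟫_ℝ := by
    refine le_trans ?_ (inner_Theta_le_zeta hP hD w)
    rw [inner_Theta]
    refine mul_le_mul_of_nonneg_left ?_ hτσ.le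
    change _ ≤ ⟪y' - y, P.Sop (y' - y)⟫_ℝ + _
    linarith [mul_nonneg (div_nonneg hP.penalty_pos.le zero_le_three)
      (sq_nonneg ‖ContinuousLinearMap.adjoint P.Aop w‖)]
  have hXi := inner_Xi_nonneg hP hD w
  generalize ⟪w, P.Xi w⟫_ℝ = ξ at *
  generalize ⟪y' - y, P.Sop (y' - y)⟫_ℝ = q at *
  calc 2 * ‖gradient P.f y' - gradient P.f y - P.Sop (y' - y)‖ ^ 2
      ≤ 2 * (‖P.Pop + P.Tcal‖ * q) := by linarith
    _ ≤ 2 * P.zeta * ‖P.Pop + P.Tcal‖ / (P.τ * P.σ) * ξ := by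
        rw [div_mul_eq_mul_div, le_div_iff₀ hτσ]
        nlinarith [mul_le_mul_of_nonneg_left h5 (norm_nonneg (P.Pop + P.Tcal))]
    _ ≤ _ := mul_le_mul_of_nonneg_right (le_max_right _ _) hXi

/-- This accounts for the first entry of ρ₀: its 3 pays for ‖r‖² and its 6σ²(τ-1)²‖𝒜*𝒜‖ for the
F-term, after multiplication by the weight τσ(2-τ)σ/3 of `decrease`. -/
theorem norm_infeas_sq_le_decrease (hP : P.Standing) (r : X) :
    ‖r‖ ^ 2 + 2 * (((P.τ - 1) * P.σ) ^ 2 * ‖P.F r‖ ^ 2)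
      ≤ P.rho₀ * (P.τ * P.σ * ((2 - P.τ) * P.σ / 3) * ‖r‖ ^ 2) := by
  have h4 := norm_F_sq_le (P := P) r
  have hτσ := hP.τσ_pos
  have hpen := hP.penalty_pos
  have hden : 0 < P.τ * P.σ ^ 2 * (2 - P.τ) := by nlinarith [mul_pos hτσ hpen]
  calc ‖r‖ ^ 2 + 2 * (((P.τ - 1) * P.σ) ^ 2 * ‖P.F r‖ ^ 2)
      ≤ ‖r‖ ^ 2 + 2 * (((P.τ - 1) * P.σ) ^ 2
        * (‖ContinuousLinearMap.adjoint P.Aop ∘L P.Aop‖ * ‖r‖ ^ 2)) := by gcongr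
    _ = (6 * P.σ ^ 2 * (P.τ - 1) ^ 2 * ‖ContinuousLinearMap.adjoint P.Aop ∘L P.Aop‖ + 3)
          / (P.τ * P.σ ^ 2 * (2 - P.τ))
          * (P.τ * P.σ * ((2 - P.τ) * P.σ / 3) * ‖r‖ ^ 2) := by
        rw [div_mul_eq_mul_div, eq_div_iff hden.ne']; ring
    _ ≤ _ := mul_le_mul_of_nonneg_right (le_max_left _ _)
        (mul_nonneg (mul_nonneg hτσ.le (div_nonneg hpen.le zero_le_three)) (sq_nonneg _))

theorem norm_sq_add_norm_sq_le_decrease (hP : P.Standing) (hD : P.ProxCond) (y y' : PiLp 2 Y)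
    (z z' : Z) :
    ‖P.infeas y' z'‖ ^ 2 + ‖gradient P.f y' - gradient P.f y - P.Sop (y' - y)
        + ((P.τ - 1) * P.σ) • P.F (P.infeas y' z')‖ ^ 2
      ≤ P.rho₀ * P.decrease (WithLp.toLp 2 (y, z)) (WithLp.toLp 2 (y', z')) := by
  have h7 := norm_deviation_sq_le_decrease hP hD y y' z z'
  have h8 := norm_infeas_sq_le_decrease hP (P.infeas y' z')
  set e := gradient P.f y' - gradient P.f y - P.Sop (y' - y)
  have h6 := parallelogram_law_with_norm ℝ e (((P.τ - 1) * P.σ) • P.F (P.infeas y' z'))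
  have e1 : ‖((P.τ - 1) * P.σ) • P.F (P.infeas y' z')‖ ^ 2
      = ((P.τ - 1) * P.σ) ^ 2 * ‖P.F (P.infeas y' z')‖ ^ 2 := by
    rw [norm_smul, mul_pow, Real.norm_eq_abs, sq_abs]
  rw [← e1] at h8
  have h9 := mul_self_nonneg ‖e - ((P.τ - 1) * P.σ) • P.F (P.infeas y' z')‖
  rw [decrease, mul_add]
  change _ ≤ _ + P.rho₀ * (P.τ * P.σ * ((2 - P.τ) * P.σ / 3) * ‖P.infeas y' z'‖ ^ 2)
  simp only [← sq] at h6 h9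
  linarith

theorem IsStep.norm_residual_le (hP : P.Standing) (hD : P.ProxCond) {x x' : X} {y y' : PiLp 2 Y}
    (z : Z) {z' zt : Z} {d : PiLp 2 Y} (hs : P.IsStep x y y' z' d) (hG : P.G x' = P.b)
    (hx' : x' = x + (P.τ * P.σ) • P.infeas y' z')
    (hzt : ContinuousLinearMap.adjoint P.G zt = ContinuousLinearMap.adjoint P.G z') :
    ‖P.residual (point x' y' zt)‖
      ≤ √(P.rho₀ * P.decrease (WithLp.toLp 2 (y, z)) (WithLp.toLp 2 (y', z'))) + ‖d‖ := by
  have h9 := norm_sq_add_norm_sq_le_decrease hP hD y y' z z'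
  have hi : P.infeas y' zt = P.infeas y' z' := by rw [infeas, infeas, hzt]
  have h1 := norm_residual_sq_le hP (z := zt) hs.1 hs.2 hG
  -- The step uses the multiplier x + σr', while the update gives x + τσr'; the mismatch is the
  -- (τ-1)σ F r' term.
  have h2 : d - gradient P.f y - P.Sop (y' - y) - P.F (x + P.σ • P.infeas y' z')
      + (gradient P.f y' + P.F x') = gradient P.f y' - gradient P.f y - P.Sop (y' - y)
        + ((P.τ - 1) * P.σ) • P.F (P.infeas y' z') + d := by
    rw [hx']
    simp only [map_add, map_smul, sub_smul, sub_mul, one_mul]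
    abel
  rw [h2, hi] at h1
  generalize gradient P.f y' - gradient P.f y - P.Sop (y' - y)
    + ((P.τ - 1) * P.σ) • P.F (P.infeas y' z') = q at *
  generalize P.rho₀ * P.decrease (WithLp.toLp 2 (y, z)) (WithLp.toLp 2 (y', z')) = M at *
  have hM0 : 0 ≤ M := (by positivity : 0 ≤ ‖P.infeas y' z'‖ ^ 2 + ‖q‖ ^ 2).trans h9
  have h10 : ‖q‖ ≤ √M := Real.le_sqrt_of_sq_le (by linarith [sq_nonneg ‖P.infeas y' z'‖])
  refine (pow_le_pow_iff_left₀ (norm_nonneg _) (by positivity) two_ne_zero).mp ?_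
  have h11 : ‖q + d‖ ^ 2 ≤ (‖q‖ + ‖d‖) ^ 2 := by gcongr; exact norm_add_le _ _
  have h12 : √M ^ 2 = M := Real.sq_sqrt hM0
  nlinarith [norm_nonneg d, mul_le_mul_of_nonneg_right h10 (norm_nonneg d)]

end Data
end SGSADMM

/-! ### Absorbing the errors and contracting the distance -/

namespace SGSADMM

/-- Bounds against each point of H pass to the infimum without a nearest point, whose existence is
unclear for a seminorm. -/
theorem le_mul_opDist_sq {V : Type*} [NormedAddCommGroup V] [InnerProductSpace ℝ V]
    {O : V →L[ℝ] V} {v : V} {H : Set V} (hH : H.Nonempty) {q t : ℝ} (ht : 0 < t)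
    (h : ∀ v' ∈ H, q ≤ t * opNorm O (v - v') ^ 2) : q ≤ t * opDist O v H ^ 2 := by
  rcases le_or_gt q 0 with hq | hq
  · exact hq.trans (mul_nonneg ht.le (sq_nonneg _))
  have h1 : √(q / t) ≤ opDist O v H := by
    refine le_csInf (hH.image _) ?_
    rintro _ ⟨v', hv', rfl⟩
    refine Real.sqrt_le_iff.mpr ⟨Real.sqrt_nonneg _, ?_⟩
    rw [div_le_iff₀' ht]
    exact h v' hv'
  have h2 := Real.sq_sqrt (div_pos hq ht).le
  have h3 : q / t ≤ opDist O v H ^ 2 := by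
    rw [← h2]; exact pow_le_pow_left₀ (Real.sqrt_nonneg _) h1 2
  rwa [div_le_iff₀' ht] at h3

/-- Absorbing an error proportional to the step length into the decrease. -/
theorem absorb_error {A B D ν n η c₁ c₂ : ℝ} (hA : 0 ≤ A) (hη : 0 ≤ η)
    (hc₁ : 0 ≤ c₁) (hc₂ : 0 ≤ c₂) (hD : 0 ≤ D) (hn : n ≤ η * ν)
    (h : A ^ 2 + D ≤ B ^ 2 + 2 * c₁ * n * A) (hstep : ν ^ 2 ≤ c₂ * D)
    (hsmall : η * (c₁ * (1 + c₂)) ≤ 1 / 2) :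
    ν ^ 2 ≤ 2 * c₂ * B ^ 2 ∧ A ^ 2 + D ≤ (1 + 2 * c₁ * (1 + c₂) * η) * B ^ 2 := by
  have hηc : 0 ≤ η * c₁ := mul_nonneg hη hc₁
  have h1 : 2 * c₁ * n * A ≤ η * c₁ * (ν ^ 2 + A ^ 2) := by
    calc 2 * c₁ * n * A ≤ 2 * c₁ * (η * ν) * A := by gcongr
      _ = η * c₁ * (2 * (ν * A)) := by ring
      _ ≤ η * c₁ * (ν ^ 2 + A ^ 2) := by
          gcongr; nlinarith [sq_nonneg (ν - A)]
  have h2 : η * c₁ * (ν ^ 2 + A ^ 2) ≤ η * (c₁ * (1 + c₂)) * (A ^ 2 + D) := by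
    have e1 : ν ^ 2 + A ^ 2 ≤ (1 + c₂) * (A ^ 2 + D) := by
      nlinarith [mul_nonneg hc₂ (sq_nonneg A)]
    calc η * c₁ * (ν ^ 2 + A ^ 2) ≤ η * c₁ * ((1 + c₂) * (A ^ 2 + D)) := by gcongr
      _ = _ := by ring
  have h3 : 0 ≤ A ^ 2 + D := by positivity
  -- Smallness of η lets at most half of A² + D be lost; this crude bound is fed back to obtain the
  -- sharp one.
  have h4 : A ^ 2 + D ≤ 2 * B ^ 2 := by
    nlinarith [mul_le_mul_of_nonneg_right hsmall h3]
  refine ⟨?_, ?_⟩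
  · nlinarith [mul_le_mul_of_nonneg_left h4 hc₂, mul_nonneg hc₂ (sq_nonneg A)]
  · have h5 : 0 ≤ η * (c₁ * (1 + c₂)) := by positivity
    nlinarith [mul_le_mul_of_nonneg_left h4 h5]

namespace Data

variable {X : Type*} {s : ℕ} [NeZero s] {Y : Fin s → Type*} {Z : Type*}
  [NormedAddCommGroup X] [InnerProductSpace ℝ X] [FiniteDimensional ℝ X]
  [∀ i, NormedAddCommGroup (Y i)] [∀ i, InnerProductSpace ℝ (Y i)]
  [∀ i, FiniteDimensional ℝ (Y i)]
  [NormedAddCommGroup Z] [InnerProductSpace ℝ Z] [FiniteDimensional ℝ Z]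
  {P : Data X Y Z}

theorem opDist_projRange (x : X) (y : PiLp 2 Y) (z : Z)
    (H : Set (WithLp 2 (X × WithLp 2 (PiLp 2 Y × Z)))) :
    opDist P.Omega (point x y z) H = opDist P.Omega (point x y (projRange P.G z)) H := by
  rw [opDist, opDist]
  congr 1
  refine Set.image_congr fun v _ => opNorm_Omega_reduce _ _ rfl rfl ?_
  change ContinuousLinearMap.adjoint P.Aop (WithLp.toLp 2 (y, z) - v.snd)
    = ContinuousLinearMap.adjoint P.Aop (P.reduce (WithLp.toLp 2 (y, z)) - v.snd)
  rw [map_sub, map_sub, adjoint_Aop_reduce]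

theorem exists_norm_fst_le_opNorm (hP : P.Standing) (hD : P.ProxCond) :
    ∃ c > 0, ∀ u : WithLp 2 (X × WithLp 2 (PiLp 2 Y × Z)),
      ‖u.snd.fst‖ ≤ c * opNorm P.Omega u := by
  obtain ⟨c, hc, h⟩ := exists_norm_le_opNorm hP hD
  refine ⟨c, hc, fun u => ?_⟩
  set u' : WithLp 2 (X × WithLp 2 (PiLp 2 Y × Z)) := WithLp.toLp 2 (u.fst, P.reduce u.snd)
  have h1 := h u' (reduce_mem u.snd)
  have h2 : opNorm P.Omega u' = opNorm P.Omega u :=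
    opNorm_Omega_reduce _ _ rfl rfl (adjoint_Aop_reduce u.snd)
  have h3 : ‖u.snd.fst‖ ^ 2 ≤ ‖u'‖ ^ 2 := by
    rw [WithLp.prod_norm_sq_eq_of_L2 u', WithLp.prod_norm_sq_eq_of_L2 u'.snd]
    change ‖u.snd.fst‖ ^ 2 ≤ _ + (‖u.snd.fst‖ ^ 2 + _)
    nlinarith [sq_nonneg ‖u'.fst‖, sq_nonneg ‖u'.snd.snd‖]
  rw [← h2]
  exact ((pow_le_pow_iff_left₀ (norm_nonneg _) (norm_nonneg _) two_ne_zero).mp h3).trans h1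

/-- The x-part of the step is τσ r', weighted in `decrease`; the (y; z)-part is controlled by
coercivity of Ξ, which is why z is projected. -/
theorem exists_step_sq_le_decrease (hP : P.Standing) (hD : P.ProxCond) :
    ∃ c > 0, ∀ (x x' : X) (y y' : PiLp 2 Y) (z z' : Z),
      x' = x + (P.τ * P.σ) • P.infeas y' z' →
      ‖point x y (projRange P.G z) - point x' y' (projRange P.G z')‖ ^ 2
        ≤ c * P.decrease (WithLp.toLp 2 (y, z)) (WithLp.toLp 2 (y', z')) := by
  obtain ⟨m, hm, h⟩ := exists_inner_Xi_lower hP hD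
  have hτσ := hP.τσ_pos
  have hpen := hP.penalty_pos
  set t := (2 - P.τ) * P.σ / 3 with ht
  have ht0 : 0 < t := by positivity
  refine ⟨1 / m + P.τ * P.σ / t, by positivity, fun x x' y y' z z' hx' => ?_⟩
  set w : WithLp 2 (PiLp 2 Y × Z) := WithLp.toLp 2 (y', z') - WithLp.toLp 2 (y, z) with hw
  have h1 : ‖point x y (projRange P.G z) - point x' y' (projRange P.G z')‖ ^ 2
      = (P.τ * P.σ) ^ 2 * ‖P.infeas y' z'‖ ^ 2 + ‖P.reduce w‖ ^ 2 := by
    rw [WithLp.prod_norm_sq_eq_of_L2]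
    congr 1
    · change ‖x - x'‖ ^ 2 = _
      rw [hx', sub_add_cancel_left, norm_neg, norm_smul, mul_pow, Real.norm_eq_abs, sq_abs]
    · rw [← norm_neg]
      congr 2
      change -(P.reduce (WithLp.toLp 2 (y, z)) - P.reduce (WithLp.toLp 2 (y', z'))) = _
      rw [neg_sub]
      refine (WithLp.ofLp_injective 2) (Prod.ext rfl ?_)
      exact (map_sub (LinearMap.range (P.G : X →ₗ[ℝ] Z)).starProjection z' z).symm
  have h2 := h _ (reduce_mem w)
  have h3 : ⟪P.reduce w, P.Xi (P.reduce w)⟫_ℝ = ⟪w, P.Xi w⟫_ℝ := by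
    rw [inner_Xi, inner_Xi, adjoint_Aop_reduce]; rfl
  rw [h3] at h2
  have h4 := inner_Xi_nonneg hP hD w
  have h5 : P.decrease (WithLp.toLp 2 (y, z)) (WithLp.toLp 2 (y', z'))
      = ⟪w, P.Xi w⟫_ℝ + P.τ * P.σ * t * ‖P.infeas y' z'‖ ^ 2 := rfl
  rw [h1, h5]
  have h6 : ‖P.reduce w‖ ^ 2 ≤ 1 / m * ⟪w, P.Xi w⟫_ℝ := by
    rw [div_mul_eq_mul_div, le_div_iff₀ hm]; linarith
  have h7 : P.τ * P.σ / t * (P.τ * P.σ * t * ‖P.infeas y' z'‖ ^ 2)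
      = (P.τ * P.σ) ^ 2 * ‖P.infeas y' z'‖ ^ 2 := by field_simp
  have h8 : 0 ≤ P.τ * P.σ / t * ⟪w, P.Xi w⟫_ℝ := by positivity
  have h9 : 0 ≤ 1 / m * (P.τ * P.σ * t * ‖P.infeas y' z'‖ ^ 2) := by positivity
  linarith

/-- One inexact step whose error is at most `η` times the step length: the squared distance
decreases up to a relative perturbation of order `η`, uniformly in all iterates. -/
theorem exists_perturbed_decrease (hP : P.Standing) (hD : P.ProxCond) (hK : P.kktSet.Nonempty) :
    ∃ C > 0, ∃ η₀ > 0, ∀ (x x' : X) (y y' : PiLp 2 Y) (z z' : Z) (d : PiLp 2 Y) (η : ℝ),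
      P.IsStep x y y' z' d → P.G x = P.b → P.G (P.infeas y' z') = 0 →
      x' = x + (P.τ * P.σ) • P.infeas y' z' → 0 ≤ η → η ≤ η₀ →
      ‖d‖ ≤ η * ‖point x y (projRange P.G z) - point x' y' (projRange P.G z')‖ →
      opDist P.Omega (point x' y' z') P.kktSet ^ 2
        + P.decrease (WithLp.toLp 2 (y, z)) (WithLp.toLp 2 (y', z'))
          ≤ (1 + C * η) * opDist P.Omega (point x y z) P.kktSet ^ 2 ∧
      ‖d‖ ≤ C * η * opDist P.Omega (point x y z) P.kktSet := by
  obtain ⟨c, hc, hfst⟩ := exists_norm_fst_le_opNorm hP hD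
  obtain ⟨c₂, hc₂, hstep⟩ := exists_step_sq_le_decrease hP hD
  have hτσ := hP.τσ_pos
  set c₁ := P.τ * P.σ * c with hc₁
  have hc₁0 : 0 < c₁ := by positivity
  -- The first summand serves the decrease, the second the bound on ‖d‖; η₀ is the smallness
  -- threshold of `absorb_error`.
  refine ⟨2 * c₁ * (1 + c₂) + √(2 * c₂), by positivity, 1 / (2 * (c₁ * (1 + c₂))), by positivity,
    fun x x' y y' z z' d η hs hG hr' hx' hη hη₀ hd => ?_⟩
  set ν := ‖point x y (projRange P.G z) - point x' y' (projRange P.G z')‖ with hν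
  set D := P.decrease (WithLp.toLp 2 (y, z)) (WithLp.toLp 2 (y', z')) with hDdef
  have hD0 : 0 ≤ D := decrease_nonneg hP hD _ _
  have hsmall : η * (c₁ * (1 + c₂)) ≤ 1 / 2 := by
    calc η * (c₁ * (1 + c₂)) ≤ 1 / (2 * (c₁ * (1 + c₂))) * (c₁ * (1 + c₂)) := by gcongr
      _ = 1 / 2 := by field_simp
  have hall : ∀ ub ∈ P.kktSet, ν ^ 2 ≤ 2 * c₂ * opNorm P.Omega (point x y z - ub) ^ 2 ∧
      opNorm P.Omega (point x' y' z' - ub) ^ 2 + D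
        ≤ (1 + 2 * c₁ * (1 + c₂) * η) * opNorm P.Omega (point x y z - ub) ^ 2 := by
    intro ub hub
    refine absorb_error (n := ‖d‖) (Real.sqrt_nonneg _) hη hc₁0.le hc₂.le hD0 hd ?_
      (hstep x x' y y' z z' hx') hsmall
    refine (hs.descent hP hD (z := z) hG hr' hx' hub).trans ?_
    have h1 : ⟪d, y' - ub.snd.fst⟫_ℝ ≤ ‖d‖ * (c * opNorm P.Omega (point x' y' z' - ub)) :=
      (real_inner_le_norm _ _).trans (by gcongr; exact hfst (point x' y' z' - ub))
    have h2 := mul_le_mul_of_nonneg_left h1 (show 0 ≤ 2 * (P.τ * P.σ) by positivity)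
    rw [hc₁]
    linarith
  have hopn : 0 ≤ opDist P.Omega (point x y z) P.kktSet := opDist_nonneg _ _ _
  refine ⟨?_, ?_⟩
  · have h1 : opDist P.Omega (point x' y' z') P.kktSet ^ 2 + D ≤ (1 + 2 * c₁ * (1 + c₂) * η)
        * opDist P.Omega (point x y z) P.kktSet ^ 2 := by
      refine le_mul_opDist_sq hK (by positivity) fun ub hub => le_trans ?_ (hall ub hub).2
      gcongr
      · exact opDist_nonneg _ _ _
      · exact opDist_le _ _ hub
    refine h1.trans ?_
    gcongr
    linarith [Real.sqrt_nonneg (2 * c₂)]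
  · have h1 : ν ^ 2 ≤ 2 * c₂ * opDist P.Omega (point x y z) P.kktSet ^ 2 :=
      le_mul_opDist_sq hK (by positivity) fun ub hub => (hall ub hub).1
    have h2 : ν ≤ √(2 * c₂) * opDist P.Omega (point x y z) P.kktSet := by
      refine (pow_le_pow_iff_left₀ (norm_nonneg _) (by positivity) two_ne_zero).mp ?_
      rw [mul_pow, Real.sq_sqrt (by positivity)]
      exact h1
    calc ‖d‖ ≤ η * ν := hd
      _ ≤ η * (√(2 * c₂) * opDist P.Omega (point x y z) P.kktSet) := by gcongr
      _ = √(2 * c₂) * η * opDist P.Omega (point x y z) P.kktSet := by ring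
      _ ≤ _ := by
          gcongr
          linarith [show 0 ≤ 2 * c₁ * (1 + c₂) by positivity]

/-- The scalar contraction: combines the perturbed decrease with the error bound. -/
theorem scaled_contraction {a a₀ K D n C η c₀ : ℝ} (hK : 0 < K) (ha : 0 ≤ a) (ha₀ : 0 ≤ a₀)
    (hD : 0 ≤ D) (hC : 0 ≤ C) (hη : 0 ≤ η) (hc₀ : 0 < c₀)
    (h1 : a ^ 2 + D ≤ (1 + C * η) * a₀ ^ 2) (h2 : n ≤ C * η * a₀)
    (h3 : a ≤ K * (√D + n / √c₀)) :
    a ≤ (√(K ^ 2 / (1 + K ^ 2)) + 2 * (C * (1 + 1 / √c₀)) * η) * a₀ := by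
  have hs : 0 < √c₀ := Real.sqrt_pos.mpr hc₀
  have hCη : 0 ≤ C * η := mul_nonneg hC hη
  rcases ha₀.eq_or_lt with h0 | h0
  · rw [← h0] at h1 ⊢
    have : a ^ 2 = 0 := le_antisymm (by linarith) (sq_nonneg a)
    rw [sq_eq_zero_iff.mp this, mul_zero]
  · rw [← div_le_iff₀ h0]
    have e1 : C * η ≤ C * (1 + 1 / √c₀) * η := by
      have : 0 ≤ C * η * (1 / √c₀) := by positivity
      linarith
    refine contraction_factor (d := D / a₀ ^ 2) hK (by positivity) (by positivity)
      (by positivity) hη ?_ ?_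
    · rw [div_pow, ← add_div, div_le_iff₀ (by positivity)]
      exact h1.trans (by gcongr)
    · rw [Real.sqrt_div hD, Real.sqrt_sq h0.le, div_le_iff₀ h0]
      refine h3.trans ?_
      rw [mul_assoc, add_mul, div_mul_cancel₀ _ h0.ne']
      gcongr
      calc n / √c₀ ≤ C * η * a₀ / √c₀ := by gcongr
        _ = C * (1 / √c₀) * η * a₀ := by ring
        _ ≤ _ := by gcongr; linarith

/-- The factor max{‖Θ‖, 1} of ρ is the price of passing from the Ω-distance to the Euclidean one,
and ρ₀ that of bounding the residual by the decrease. Subregularity is invoked only at the projected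
point. -/
theorem IsStep.opDist_le_of_subregular (hP : P.Standing) (hD : P.ProxCond)
    {x x' : X} {y y' : PiLp 2 Y} (z : Z) {z' : Z} {d : PiLp 2 Y} (hs : P.IsStep x y y' z' d)
    (hK : P.kktSet.Nonempty) (hG : P.G x' = P.b)
    (hx' : x' = x + (P.τ * P.σ) • P.infeas y' z') {κ : ℝ} (hκ : 0 < κ)
    (hsub : Metric.infDist (point x' y' (projRange P.G z')) P.kktSet
      ≤ κ * ‖P.residual (point x' y' (projRange P.G z'))‖) :
    opDist P.Omega (point x' y' z') P.kktSet ≤ κ * √P.rho *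
      (√(P.decrease (WithLp.toLp 2 (y, z)) (WithLp.toLp 2 (y', z'))) + ‖d‖ / √P.rho₀) := by
  have h0 := rho₀_pos hP
  have hs0 : 0 < √P.rho₀ := Real.sqrt_pos.mpr h0
  have h1 := hs.norm_residual_le hP hD z hG hx' (adjoint_projRange P.G z')
  rw [opDist_projRange]
  refine (opDist_Omega_le_infDist hK _).trans ?_
  rw [rho_eq, Real.sqrt_mul h0.le]
  rw [Real.sqrt_mul h0.le] at h1
  calc √(max ‖P.Theta‖ 1) * Metric.infDist (point x' y' (projRange P.G z')) P.kktSet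
      ≤ √(max ‖P.Theta‖ 1) * (κ * (√P.rho₀ * √(P.decrease (WithLp.toLp 2 (y, z))
          (WithLp.toLp 2 (y', z'))) + ‖d‖)) := by
        gcongr
        exact hsub.trans (by gcongr)
    _ = _ := by field_simp

end Data

end SGSADMM

theorem mainTheorem6
    {X : Type*} {s : ℕ} [NeZero s] {Y : Fin s → Type*} {Z : Type*}
    [NormedAddCommGroup X] [InnerProductSpace ℝ X] [FiniteDimensional ℝ X]
    [∀ i, NormedAddCommGroup (Y i)] [∀ i, InnerProductSpace ℝ (Y i)]
    [∀ i, FiniteDimensional ℝ (Y i)]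
    [NormedAddCommGroup Z] [InnerProductSpace ℝ Z] [FiniteDimensional ℝ Z]
    (P : SGSADMM.Data X Y Z) (hP : P.Standing)
    (hK : P.kktSet.Nonempty) (hD : P.ProxCond) :
    ∃ C : ℝ, 0 ≤ C ∧
      ∀ (ε : ℕ → ℝ) (x : ℕ → X) (y yh : ℕ → PiLp 2 Y) (z : ℕ → Z) (δt δ : ℕ → ∀ i, Y i)
        (u v : ℕ → WithLp 2 (X × WithLp 2 (PiLp 2 Y × Z)))
        (vstar : WithLp 2 (X × WithLp 2 (PiLp 2 Y × Z))),
        P.IsRun ε x y yh z δt δ →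
        (∀ k, u k = SGSADMM.point (x k) (y k) (z k)) →
        (∀ k, v k = SGSADMM.point (x k) (y k) (SGSADMM.projRange P.G (z k))) →
        vstar ∈ P.kktSet →
        Tendsto v atTop (𝓝 vstar) →
        (∀ k, SGSADMM.opDist P.Omega (u k) P.kktSet = SGSADMM.opDist P.Omega (v k) P.kktSet) ∧
        (P.b - P.G (x 0) = 0 →
          (∀ k, P.gam (x k) (y (k + 1)) (z (k + 1)) = 0) →
          ∀ κ : ℝ, 0 < κ →
          SGSADMM.MetricSubregular P.residual P.kktSet κ vstar →
          ∀ ηt : ℕ → ℝ, (∀ k, 0 ≤ ηt k) → Tendsto ηt atTop (𝓝 0) →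
          ∀ k₀ : ℕ,
          (∀ k, k₀ ≤ k → ∀ i, (i ≠ 0 → ‖δt k i‖ ≤ ηt k * ‖v k - v (k + 1)‖) ∧
            ‖δ k i‖ ≤ ηt k * ‖v k - v (k + 1)‖) →
          ∃ kbar : ℕ, k₀ ≤ kbar ∧ ∃ q : ℝ, q < 1 ∧ ∀ k, kbar ≤ k →
            √(κ ^ 2 * P.rho / (1 + κ ^ 2 * P.rho)) + C * ηt k ≤ q ∧
            SGSADMM.opDist P.Omega (u (k + 1)) P.kktSet ≤
              (√(κ ^ 2 * P.rho / (1 + κ ^ 2 * P.rho)) + C * ηt k)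
                * SGSADMM.opDist P.Omega (u k) P.kktSet) := by
  obtain ⟨cd, hcd, herr⟩ := SGSADMM.Data.exists_sweepError_le P
  obtain ⟨C, hC, η₀, hη₀, hdec⟩ := SGSADMM.Data.exists_perturbed_decrease hP hD hK
  have hρ₀ := SGSADMM.Data.rho₀_pos hP
  have hρ : 0 < P.rho := mul_pos hρ₀ (by positivity)
  -- The constant of `scaled_contraction`, times the factor `cd` from block errors to the aggregated
  -- error. It is fixed before the run and before κ.
  refine ⟨2 * (C * (1 + 1 / √P.rho₀)) * cd, by positivity, ?_⟩
  intro ε x y yh z δt δ u v vstar hrun hu hv _ hlim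
  refine ⟨fun k => by rw [hu, hv, SGSADMM.Data.opDist_projRange], ?_⟩
  intro hb hγ κ hκ ⟨r, hr, hsub⟩ ηt hηt hηlim k₀ hδ
  set t := √(κ ^ 2 * P.rho / (1 + κ ^ 2 * P.rho)) with ht
  set C' := 2 * (C * (1 + 1 / √P.rho₀)) * cd with hC'
  have ht1 : t < 1 := by
    have h0 : 0 < κ ^ 2 * P.rho := by positivity
    rw [ht, Real.sqrt_lt' one_pos, one_pow, div_lt_one (by positivity)]
    linarith
  have hlim1 : Tendsto (fun k => t + C' * ηt k) atTop (𝓝 (t + C' * 0)) :=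
    (hηlim.const_mul C').const_add t
  have hlim2 : Tendsto (fun k => ηt k * cd) atTop (𝓝 (0 * cd)) := hηlim.mul_const cd
  have hlim3 : Tendsto (fun k => ‖v (k + 1) - vstar‖) atTop (𝓝 0) :=
    tendsto_iff_norm_sub_tendsto_zero.mp (hlim.comp (tendsto_add_atTop_nat 1))
  -- k ≥ 1 is needed because G rᵏ = 0 may fail at k = 0. The midpoint (t + 1)/2 is a uniform bound
  -- below 1. The last condition concerns v (k + 1), where subregularity is applied.
  have hev : ∀ᶠ k in atTop, k₀ ≤ k ∧ 1 ≤ k ∧ t + C' * ηt k ≤ (t + 1) / 2 ∧ ηt k * cd ≤ η₀ ∧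
      ‖v (k + 1) - vstar‖ ≤ r := by
    filter_upwards [eventually_ge_atTop k₀, eventually_ge_atTop 1,
      hlim1.eventually_le_const (show t + C' * 0 < (t + 1) / 2 by linarith),
      hlim2.eventually_le_const (show 0 * cd < η₀ by linarith),
      hlim3.eventually_le_const hr] with k h1 h2 h3 h4 h5 using ⟨h1, h2, h3, h4, h5⟩
  obtain ⟨kbar, hkbar⟩ := eventually_atTop.mp hev
  refine ⟨kbar, (hkbar kbar le_rfl).1, (t + 1) / 2, by linarith, fun k hk => ?_⟩
  obtain ⟨hk0, hk1, hk2, hk3, hk4⟩ := hkbar k hk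
  refine ⟨hk2, ?_⟩
  obtain ⟨j, rfl⟩ : ∃ j, k = j + 1 := ⟨k - 1, by omega⟩
  have hG := hrun.G_eq hP hb hγ
  have hstep := hrun.isStep hP hD (hG j).2 (hG (j + 1)).2
  have hd := herr (δ (j + 1)) (δt (j + 1)) (ηt (j + 1) * ‖v (j + 1) - v (j + 1 + 1)‖)
    (mul_nonneg (hηt _) (norm_nonneg _)) (hδ (j + 1) hk0)
  rw [← mul_assoc, mul_comm cd, hv, hv] at hd
  obtain ⟨h1, h2⟩ := hdec (x (j + 1)) (x (j + 1 + 1)) (y (j + 1)) (y (j + 1 + 1)) (z (j + 1))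
    (z (j + 1 + 1)) _ (ηt (j + 1) * cd) hstep (hG (j + 1)).1 (hG (j + 1)).2 (hrun.step4 (j + 1))
    (mul_nonneg (hηt _) hcd.le) hk3 hd
  have h3 := hstep.opDist_le_of_subregular hP hD (z (j + 1)) hK (hG (j + 1 + 1)).1
    (hrun.step4 (j + 1)) hκ (by rw [← hv]; exact hsub _ hk4)
  have h4 := SGSADMM.Data.scaled_contraction (by positivity) (SGSADMM.Data.opDist_nonneg _ _ _)
    (SGSADMM.Data.opDist_nonneg _ _ _) (SGSADMM.Data.decrease_nonneg hP hD _ _) hC.le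
    (mul_nonneg (hηt _) hcd.le) hρ₀ h1 h2 h3
  rw [mul_pow, Real.sq_sqrt hρ.le] at h4
  rw [hu, hu]
  refine h4.trans (le_of_eq ?_)
  rw [hC', ht]
  ring
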